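/- Let $n\ge 1$ be an integer. For a bounded measurable function $m:\mathbb R^n\to\mathbb C$ and a Schwartz function $f$ on $\mathbb R^n$ put $$T_m f(x)=\int_{\mathbb R^n}\widehat f(\xi)\,m(\xi)\,e^{2\pi i x\cdot\xi}\,d\xi,\qquad \widehat f(\xi)=\int_{\mathbb R^n} f(x)\,e^{-2\pi i x\cdot\xi}\,dx .$$ For $s>0$ let $(I-\Delta)^{s/2}$ be the operator on tempered distributions that acts on the Fourier transform side as multiplication by $(1+4\pi^2|\xi|^2)^{s/2}$, and for $1<r<\infty$ let $\|g\|_{L^r_s}=\|(I-\Delta)^{s/2}g\|_{L^r}$, understood as $\infty$ if $(I-\Delta)^{s/2}g$ is not a function in $L^r(\mathbb R^n)$. Theorem. Let $1<p<\infty$, $p\neq 2$, and let $s>0$ be such that $\left|\frac1p-\frac12\right|=\frac sn$. Let $\phi:\mathbb R^n\to\mathbb C$ be a smooth function supported in $\{\xi\in\mathbb R^n: 1/2<|\xi|<2\}$, and let $1<r<\infty$. Then there is no finite constant $C$ such that the inequality $$\|T_m f\|_{L^p}\le C\,\sup_{D\in\mathbb Z}\|\phi(\xi)\,m(2^D\xi)\|_{L^r_s}\,\|f\|_{L^p}$$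 holds for all bounded measurable functions $m$ on $\mathbb R^n$ and all Schwartz functions $f$ on $\mathbb R^n$. -/

import Mathlib

open MeasureTheory FourierTransform TemperedDistribution
open scoped SchwartzMap ENNReal NNReal ContDiff

noncomputable section

/-- The Fourier multiplier operator
`T_m f (x) = ∫ m(ξ) f̂(ξ) e^{2πi x·ξ} dξ`, where `f̂(ξ) = ∫ f(x) e^{-2πi x·ξ} dx`. -/
def multiplierOp {n : ℕ} (m : EuclideanSpace ℝ (Fin n) → ℂ)
    (f : 𝓢(EuclideanSpace ℝ (Fin n), ℂ)) : EuclideanSpace ℝ (Fin n) → ℂ :=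
  𝓕⁻ (fun ξ ↦ m ξ * 𝓕 (f : EuclideanSpace ℝ (Fin n) → ℂ) ξ)

/-- The symbol `(1 + 4π²|ξ|²)^{s/2}` of `(I - Δ)^{s/2}`. -/
def besselSymbol (n : ℕ) (s : ℝ) (ξ : EuclideanSpace ℝ (Fin n)) : ℂ :=
  (((1 + 4 * Real.pi ^ 2 * ‖ξ‖ ^ 2) ^ (s / 2) : ℝ) : ℂ)

/-- The symbol has temperate growth, so that the multiplier operator with this symbol is defined on
all tempered distributions. -/
theorem besselSymbol_hasTemperateGrowth (n : ℕ) (s : ℝ) :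
    (besselSymbol n s).HasTemperateGrowth := by
  have h : (fun ξ : EuclideanSpace ℝ (Fin n) ↦
      (((1 + ‖(2 * Real.pi) • ξ‖ ^ 2) ^ (s / 2) : ℝ) : ℂ)).HasTemperateGrowth :=
    Function.HasTemperateGrowth.comp
      (g := fun ξ : EuclideanSpace ℝ (Fin n) ↦ (((1 + ‖ξ‖ ^ 2) ^ (s / 2) : ℝ) : ℂ))
      (f := fun ξ : EuclideanSpace ℝ (Fin n) ↦ (2 * Real.pi) • ξ)
      (by fun_prop) (by fun_prop)
  have e : besselSymbol n s = fun ξ : EuclideanSpace ℝ (Fin n) ↦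
      (((1 + ‖(2 * Real.pi) • ξ‖ ^ 2) ^ (s / 2) : ℝ) : ℂ) := by
    funext ξ
    have h2 : ‖(2 * Real.pi) • ξ‖ ^ 2 = 4 * Real.pi ^ 2 * ‖ξ‖ ^ 2 := by
      rw [norm_smul, Real.norm_of_nonneg (by positivity)]
      ring
    rw [besselSymbol, h2]
  rw [e]
  exact h

/-- The operator `(I - Δ)^{s/2}` on tempered distributions. -/
def besselOp (n : ℕ) (s : ℝ) :
    𝓢'(EuclideanSpace ℝ (Fin n), ℂ) →L[ℂ] 𝓢'(EuclideanSpace ℝ (Fin n), ℂ) :=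
  fourierMultiplierCLM ℂ (besselSymbol n s)

/-- The tempered distribution `u` is given by the function `g`. -/
def IsGivenBy {n : ℕ} (u : 𝓢'(EuclideanSpace ℝ (Fin n), ℂ))
    (g : EuclideanSpace ℝ (Fin n) → ℂ) : Prop :=
  ∀ ψ : 𝓢(EuclideanSpace ℝ (Fin n), ℂ),
    Integrable (fun x ↦ ψ x * g x) ∧ u ψ = ∫ x, ψ x * g x

/-- The norm `‖g‖_{L^r_s} = ‖(I - Δ)^{s/2} g‖_{L^r}` of a function `g` that defines a tempered
distribution. It is `∞` if the tempered distribution `(I - Δ)^{s/2} g` is not given by a function in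
`L^r`; otherwise that function `h` is unique up to null sets, and the infimum is its norm. -/
def sobolevNorm {n : ℕ} (s r : ℝ) (g : EuclideanSpace ℝ (Fin n) → ℂ) : ℝ≥0∞ :=
  ⨅ (u : 𝓢'(EuclideanSpace ℝ (Fin n), ℂ)) (_ : IsGivenBy u g)
    (h : EuclideanSpace ℝ (Fin n) → ℂ) (_ : MemLp h (ENNReal.ofReal r))
    (_ : IsGivenBy (besselOp n s u) h),
    eLpNorm h (ENNReal.ofReal r)

end

/-! The counterexample is a random sum of chirps. Take m = Σ_j ε_j N_j^{-s} e^{iN_j|ξ|²} χ(ξ), with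
j running over K indices, ε_j random signs, N_j ≥ 1 frequencies to be chosen, and χ an even bump
supported in an annulus.

Upper bound. Applying (I-Δ)^{s/2} to e^{iN|ξ|²} a(ξ) costs at most a factor of order N^s, pointwise
and with an integrable weight (`exists_norm_besselSymbol_chirpMul_le`). Each normalized chirp
therefore has Sobolev norm O(1), and by Khintchine's inequality the random sum has norm O(√K) on
average (`exists_sum_signs_iSup_sobolevNorm_le`). Only three dyadic scales D contribute, because χ
lives in an annulus.

Lower bound. Let q be whichever of p, p' is less than 2, so that sq = n(2-q)/2. Test on the inverse
transform of χ. The inverse transform k of e^{iN|ξ|²}χ² is O(N^{-n/2}) by dispersion, while its L²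
norm does not depend on N. Since |k|² ≤ |k|^q sup|k|^{2-q}, the L^q norm of N^{-s}k is bounded
below. As N grows, the mass leaves every fixed ball, so the N_j can be chosen successively with a
fixed amount of L^q mass of the j-th term on the j-th of K disjoint shells. Averaging over signs
removes the other terms on each shell, and the q-th power of the L^q norm of the sum is on average
at least cK (`exists_card_mul_le_sum_signs_integral`).

An inequality with constant C would give cK ≤ C'K^{q/2} for every K, which is false since q < 2. If
p > 2, the inequality is first moved from p to q = p' by duality
(`eLpNorm_fourierInv_smulLeftCLM_le`). -/

/-! ### Averages over random signs. -/

section Signs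

/-- Changing all signs except one averages a signed sum to the remaining term. -/
theorem card_mul_rpow_norm_le_sum_signs {ι : Type*} [Fintype ι] [DecidableEq ι] {F : Type*}
    [NormedAddCommGroup F] [NormedSpace ℝ F] (f : ι → F) (j : ι)
    {p : ℝ} (hp : 1 ≤ p) :
    (Fintype.card (ι → ℤˣ) : ℝ) * ‖f j‖ ^ p ≤
      ∑ ε : ι → ℤˣ, ‖∑ i, ((ε i : ℤ) : ℝ) • f i‖ ^ p := by
  set S : (ι → ℤˣ) → F := fun ε ↦ ∑ i, ((ε i : ℤ) : ℝ) • f i with hS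
  let τ : Equiv.Perm (ι → ℤˣ) := Function.Involutive.toPerm
    (fun ε i ↦ if i = j then ε i else -ε i) (fun ε ↦ by ext i; by_cases h : i = j <;> simp [h])
  have hτ_apply : ∀ ε i, τ ε i = if i = j then ε i else -ε i := fun _ _ ↦ rfl
  have hτ : ∀ ε, S ε + S (τ ε) = (2 : ℝ) • ((ε j : ℤ) : ℝ) • f j := by
    intro ε
    rw [hS, ← Finset.sum_add_distrib, Finset.sum_eq_single j]
    · simp [hτ_apply, two_smul]
    · intro i _ hi
      simp [hτ_apply, hi]
    · simp
  -- Convexity of x^p applied to the midpoint of the two norms; since τ permutes the sign patterns,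
  -- summing over ε gives the claim.
  have key : ∀ ε, 2 * ‖f j‖ ^ p ≤ ‖S ε‖ ^ p + ‖S (τ ε)‖ ^ p := by
    intro ε
    have h1 : ‖f j‖ ≤ (‖S ε‖ + ‖S (τ ε)‖) / 2 := by
      have := norm_add_le (S ε) (S (τ ε))
      rw [hτ, norm_smul, norm_smul] at this
      have h3 : ‖((ε j : ℤ) : ℝ)‖ = 1 := by
        rcases Int.units_eq_one_or (ε j) with h | h <;> simp [h]
      rw [h3] at this
      norm_num at this
      linarith
    have h2 := (convexOn_rpow hp).2 (Set.mem_Ici.2 (norm_nonneg (S ε)))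
      (Set.mem_Ici.2 (norm_nonneg (S (τ ε)))) (by norm_num : (0 : ℝ) ≤ 1 / 2)
      (by norm_num : (0 : ℝ) ≤ 1 / 2) (by norm_num)
    simp only [smul_eq_mul] at h2
    have h3 := Real.rpow_le_rpow (norm_nonneg _) h1 (by linarith : 0 ≤ p)
    have h4 : (1 / 2 * ‖S ε‖ + 1 / 2 * ‖S (τ ε)‖) = (‖S ε‖ + ‖S (τ ε)‖) / 2 := by ring
    rw [h4] at h2
    linarith
  have hsum := Finset.sum_le_sum (fun ε (_ : ε ∈ Finset.univ) ↦ key ε)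
  rw [Finset.sum_add_distrib, Equiv.sum_comp τ (fun ε ↦ ‖S ε‖ ^ p)] at hsum
  simp only [Finset.sum_const, nsmul_eq_mul, Finset.card_univ] at hsum
  linarith

theorem sum_signs_exp {ι : Type*} [Fintype ι] [DecidableEq ι] (a : ι → ℝ) :
    ∑ ε : ι → ℤˣ, Real.exp (∑ i, ((ε i : ℤ) : ℝ) * a i) = ∏ i, (2 * Real.cosh (a i)) := by
  have : ∀ i, 2 * Real.cosh (a i) = ∑ e : ℤˣ, Real.exp (((e : ℤ) : ℝ) * a i) := by
    intro i
    rw [UnitsInt.univ, Finset.sum_pair (by decide), Real.cosh_eq]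
    simp
    ring
  simp_rw [this, Finset.prod_univ_sum, Fintype.piFinset_univ, Real.exp_sum]

/-- Exponential moments give Khintchine: |x|^R ≤ R!(e^x + e^{-x}), the sign average of the
exponential factors into a product of cosh a_i, and cosh a ≤ e^{a²/2} bounds that product by e^{1/2}
when Σ a_i² ≤ 1. -/
theorem sum_signs_abs_pow_le_of_abs_le_one {ι : Type*} [Fintype ι] [DecidableEq ι] (a : ι → ℝ)
    {c : ℝ} (hc : ∀ i, |a i| ≤ c) (hc1 : Fintype.card ι * c ^ 2 ≤ 1) (R : ℕ) :
    ∑ ε : ι → ℤˣ, |∑ i, ((ε i : ℤ) : ℝ) * a i| ^ R ≤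
      Fintype.card (ι → ℤˣ) * (R.factorial * (2 * Real.exp (1 / 2))) := by
  have hprod : ∀ b : ι → ℝ, (∀ i, |b i| ≤ c) →
      ∏ i, (2 * Real.cosh (b i)) ≤ Fintype.card (ι → ℤˣ) * Real.exp (1 / 2) := by
    intro b hb
    rw [Finset.prod_mul_distrib]
    have h1 : ∏ i : ι, (2 : ℝ) = Fintype.card (ι → ℤˣ) := by
      simp
    rw [h1]
    gcongr
    calc ∏ i, Real.cosh (b i) ≤ ∏ i : ι, Real.exp (c ^ 2 / 2) := by
          refine Finset.prod_le_prod (fun i _ ↦ (Real.cosh_pos _).le) fun i _ ↦ ?_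
          refine (Real.cosh_le_exp_half_sq _).trans (Real.exp_le_exp.2 ?_)
          have := sq_le_sq' (neg_le_of_abs_le (hb i)) (le_of_abs_le (hb i))
          linarith
      _ = Real.exp (Fintype.card ι * (c ^ 2 / 2)) := by
          rw [Finset.prod_const, ← Real.exp_nat_mul, Finset.card_univ]
      _ ≤ _ := Real.exp_le_exp.2 (by linarith)
  have hpt : ∀ x : ℝ, |x| ^ R ≤ R.factorial * (Real.exp x + Real.exp (-x)) := by
    intro x
    have h1 := Real.pow_div_factorial_le_exp |x| (abs_nonneg x) R
    rw [div_le_iff₀ (by positivity)] at h1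
    have h2 : Real.exp |x| ≤ Real.exp x + Real.exp (-x) := by
      rcases abs_choice x with h | h <;> rw [h] <;>
        linarith [Real.exp_pos x, Real.exp_pos (-x)]
    nlinarith [(Nat.cast_pos (α := ℝ)).2 R.factorial_pos]
  refine (Finset.sum_le_sum fun ε _ ↦ hpt _).trans ?_
  rw [← Finset.mul_sum, Finset.sum_add_distrib, sum_signs_exp]
  have h2 : ∑ ε : ι → ℤˣ, Real.exp (-∑ i, ((ε i : ℤ) : ℝ) * a i) = ∏ i, (2 * Real.cosh (-a i)) := by
    rw [← sum_signs_exp]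
    simp [Finset.sum_neg_distrib]
  rw [h2]
  have h3 := hprod a hc
  have h4 := hprod (fun i ↦ -a i) (by simpa using hc)
  have h5 : (0 : ℝ) < R.factorial := by positivity
  nlinarith

/-- Khintchine's inequality for bounded coefficients. -/
theorem sum_signs_norm_pow_le {ι : Type*} [Fintype ι] [DecidableEq ι] (h : ι → ℂ)
    {b : ℝ} (hb : ∀ i, ‖h i‖ ≤ b) (R : ℕ) :
    ∑ ε : ι → ℤˣ, ‖∑ i, ((ε i : ℤ) : ℝ) • h i‖ ^ R ≤
      Fintype.card (ι → ℤˣ) * (2 ^ R * (2 * (R.factorial * (2 * Real.exp (1 / 2))))) *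
        (Real.sqrt (Fintype.card ι) * b) ^ R := by
  rcases isEmpty_or_nonempty ι with hι | hι
  · rcases Nat.eq_zero_or_pos R with rfl | hR
    · simp
      have := Real.add_one_le_exp (1 / 2)
      norm_num at this
      linarith
    · simp [hR.ne']
  have hb0 : 0 ≤ b := (norm_nonneg _).trans (hb (Classical.arbitrary ι))
  rcases hb0.eq_or_lt with rfl | hb0
  · have : ∀ i, h i = 0 := fun i ↦ norm_le_zero_iff.1 (hb i)
    rcases Nat.eq_zero_or_pos R with rfl | hR
    · simp
      have := Real.add_one_le_exp (1 / 2)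
      norm_num at this
      have h2 : (0 : ℝ) < 2 ^ Fintype.card ι := by positivity
      nlinarith
    · simp [hR.ne', this]
  have hK : (0 : ℝ) < Fintype.card ι := by exact_mod_cast Fintype.card_pos
  -- Dividing by c makes the sum of squared coefficient bounds equal to 1; real and imaginary parts
  -- are then treated separately.
  set c := Real.sqrt (Fintype.card ι) * b with hc
  have hc0 : 0 < c := by positivity
  have hsq : Fintype.card ι * (b / c) ^ 2 ≤ 1 := by
    rw [hc, div_pow, mul_pow, Real.sq_sqrt hK.le]
    apply le_of_eq
    field_simp
  have hre := sum_signs_abs_pow_le_of_abs_le_one (fun i ↦ (h i).re / c) (c := b / c) (by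
    intro i
    rw [abs_div, abs_of_pos hc0]
    gcongr
    exact (Complex.abs_re_le_norm _).trans (hb i)) hsq R
  have him := sum_signs_abs_pow_le_of_abs_le_one (fun i ↦ (h i).im / c) (c := b / c) (by
    intro i
    rw [abs_div, abs_of_pos hc0]
    gcongr
    exact (Complex.abs_im_le_norm _).trans (hb i)) hsq R
  have hpt : ∀ ε : ι → ℤˣ, ‖∑ i, ((ε i : ℤ) : ℝ) • h i‖ ^ R ≤
      2 ^ R * c ^ R * (|∑ i, ((ε i : ℤ) : ℝ) * ((h i).re / c)| ^ R +
        |∑ i, ((ε i : ℤ) : ℝ) * ((h i).im / c)| ^ R) := by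
    intro ε
    set z := ∑ i, ((ε i : ℤ) : ℝ) • h i with hz
    have e1 : ∑ i, ((ε i : ℤ) : ℝ) * ((h i).re / c) = z.re / c := by
      simp [hz, Finset.sum_div, mul_div_assoc]
    have e2 : ∑ i, ((ε i : ℤ) : ℝ) * ((h i).im / c) = z.im / c := by
      simp [hz, Finset.sum_div, mul_div_assoc]
    rw [e1, e2, abs_div, abs_div, abs_of_pos hc0, div_pow, div_pow, ← add_div, mul_assoc,
      mul_div_cancel₀ _ (by positivity)]
    calc ‖z‖ ^ R ≤ (2 * max |z.re| |z.im|) ^ R := by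
          gcongr
          have := Complex.norm_le_abs_re_add_abs_im z
          linarith [le_max_left |z.re| |z.im|, le_max_right |z.re| |z.im|]
      _ ≤ 2 ^ R * (|z.re| ^ R + |z.im| ^ R) := by
          rw [mul_pow]
          gcongr
          rcases max_choice |z.re| |z.im| with h | h <;> rw [h]
          · linarith [pow_nonneg (abs_nonneg z.im) R]
          · linarith [pow_nonneg (abs_nonneg z.re) R]
  refine (Finset.sum_le_sum fun ε _ ↦ hpt ε).trans ?_
  rw [← Finset.mul_sum, Finset.sum_add_distrib]
  have : (0 : ℝ) ≤ 2 ^ R * c ^ R := by positivity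
  calc _ ≤ 2 ^ R * c ^ R * (Fintype.card (ι → ℤˣ) * (R.factorial * (2 * Real.exp (1 / 2))) +
        Fintype.card (ι → ℤˣ) * (R.factorial * (2 * Real.exp (1 / 2)))) := by gcongr
    _ = _ := by ring

end Signs

/-! ### Gaussian multipliers with complex parameter. -/

section Gaussian

variable {V : Type*} [NormedAddCommGroup V] [InnerProductSpace ℝ V] [FiniteDimensional ℝ V]
  [MeasurableSpace V] [BorelSpace V]

/-- Moving the Fourier transform from g to the modulated Gaussian. Real b gives the heat semigroup;
b = 1 - iλ gives the dispersive estimate. -/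
theorem fourierInv_gaussian_mul_fourier {b : ℂ} (hb : 0 < b.re) {g : V → ℂ} (hg : Integrable g)
    (ξ : V) :
    𝓕⁻ (fun x ↦ Complex.exp (-b * (‖x‖ : ℂ) ^ 2) * 𝓕 g x) ξ =
      (Real.pi / b) ^ (Module.finrank ℝ V / 2 : ℂ) *
        ∫ y, g y * Complex.exp (-Real.pi ^ 2 * (‖ξ - y‖ : ℂ) ^ 2 / b) := by
  rw [Real.fourierInv_eq']
  have h1 := VectorFourier.integral_fourierIntegral_smul_eq_flip (L := innerₗ V)
    Real.continuous_fourierChar continuous_inner hg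
    (GaussianFourier.integrable_cexp_neg_mul_sq_norm_add hb (2 * Real.pi * Complex.I) ξ)
  have h2 : ∀ y, VectorFourier.fourierIntegral 𝐞 volume (innerₗ V).flip
      (fun v : V ↦ Complex.exp (-b * (‖v‖ : ℂ) ^ 2 + 2 * Real.pi * Complex.I * (inner ℝ ξ v : ℝ))) y
      = (Real.pi / b) ^ (Module.finrank ℝ V / 2 : ℂ) *
        Complex.exp (-Real.pi ^ 2 * (‖ξ - y‖ : ℂ) ^ 2 / b) := by
    intro y
    rw [← fourier_gaussian_innerProductSpace' hb ξ y]
    simp only [Real.fourier_eq, VectorFourier.fourierIntegral, LinearMap.flip_apply,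
      innerₗ_apply_apply, real_inner_comm]
  simp_rw [h2] at h1
  calc _ = ∫ x, VectorFourier.fourierIntegral 𝐞 volume (innerₗ V) g x •
        Complex.exp (-b * (‖x‖ : ℂ) ^ 2 + 2 * Real.pi * Complex.I * (inner ℝ ξ x : ℝ)) := by
        congr 1
        ext x
        rw [Complex.exp_add, real_inner_comm x ξ]
        change _ * (_ * VectorFourier.fourierIntegral 𝐞 volume (innerₗ V) g x) = _ * _
        push_cast
        ring_nf
    _ = _ := by
        rw [h1, ← integral_const_mul]
        congr 1
        ext y
        simp only [smul_eq_mul]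
        ring

end Gaussian

/-! ### The heat semigroup of I - Δ in a weighted supremum norm. -/

section Heat

/-- The weight `(1 + |ξ|)^{-(n+1)}`. -/
noncomputable def decayWeight (n : ℕ) (ξ : EuclideanSpace ℝ (Fin n)) : ℝ :=
  ((1 + ‖ξ‖) ^ (n + 1))⁻¹

theorem decayWeight_pos {n : ℕ} (ξ : EuclideanSpace ℝ (Fin n)) : 0 < decayWeight n ξ := by
  unfold decayWeight; positivity

theorem decayWeight_le_one {n : ℕ} (ξ : EuclideanSpace ℝ (Fin n)) : decayWeight n ξ ≤ 1 :=
  inv_le_one_of_one_le₀ (one_le_pow₀ (by linarith [norm_nonneg ξ]))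

theorem continuous_decayWeight (n : ℕ) : Continuous (decayWeight n) := by
  unfold decayWeight
  exact Continuous.inv₀ (by fun_prop) (fun ξ ↦ by positivity)

theorem integrable_decayWeight (n : ℕ) : Integrable (decayWeight n) := by
  have := integrable_one_add_norm (E := EuclideanSpace ℝ (Fin n)) (μ := volume)
    (r := (n + 1 : ℕ)) (by simp)
  refine this.congr (Filter.Eventually.of_forall fun ξ ↦ ?_)
  simp only [decayWeight]
  rw [Real.rpow_neg (by positivity), Real.rpow_natCast]

theorem decayWeight_le_mul {n : ℕ} (ξ y : EuclideanSpace ℝ (Fin n)) :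
    decayWeight n y ≤ decayWeight n ξ * (1 + ‖ξ - y‖) ^ (n + 1) := by
  unfold decayWeight
  rw [inv_mul_eq_div, le_div_iff₀ (by positivity), inv_mul_le_iff₀ (by positivity), ← mul_pow]
  gcongr
  have : ‖ξ‖ ≤ ‖y‖ + ‖ξ - y‖ := by
    calc ‖ξ‖ = ‖y + (ξ - y)‖ := by congr 1; abel
      _ ≤ _ := norm_add_le _ _
  nlinarith [norm_nonneg y, norm_nonneg (ξ - y)]

theorem SchwartzMap.exists_norm_le_decayWeight {n : ℕ} (f : 𝓢(EuclideanSpace ℝ (Fin n), ℂ)) :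
    ∃ C, 0 ≤ C ∧ ∀ ξ, ‖f ξ‖ ≤ C * decayWeight n ξ := by
  have h := fun x ↦ SchwartzMap.one_add_le_sup_seminorm_apply (𝕜 := ℝ) (m := (n + 1, 0))
    (k := n + 1) (n := 0) le_rfl le_rfl f x
  simp only [norm_iteratedFDeriv_zero] at h
  refine ⟨_, le_trans (by positivity) (h 0), fun ξ ↦ ?_⟩
  rw [decayWeight, ← div_eq_mul_inv, le_div_iff₀ (by positivity), mul_comm]
  exact h ξ

/-- The symbol `1 + 4π²|x|²` of `I - Δ`. -/
noncomputable def helmholtzSymbol {n : ℕ} (x : EuclideanSpace ℝ (Fin n)) : ℝ :=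
  1 + 4 * Real.pi ^ 2 * ‖x‖ ^ 2

theorem one_le_helmholtzSymbol {n : ℕ} (x : EuclideanSpace ℝ (Fin n)) :
    1 ≤ helmholtzSymbol x := by
  unfold helmholtzSymbol
  have : 0 ≤ 4 * Real.pi ^ 2 * ‖x‖ ^ 2 := by positivity
  linarith

theorem continuous_helmholtzSymbol (n : ℕ) :
    Continuous (helmholtzSymbol : EuclideanSpace ℝ (Fin n) → ℝ) := by
  unfold helmholtzSymbol
  fun_prop

/-- The damping e^{-t} comes from the zeroth-order term of I - Δ. Since t + z²/(8t) ≥ z/2, the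
exponential is at most e^{-z/2} uniformly in t, and this beats any polynomial. -/
theorem one_add_norm_pow_mul_exp_le {t z : ℝ} (ht : 0 < t) (hz : 0 ≤ z) (M : ℕ) :
    (1 + z) ^ M * Real.exp (-t - z ^ 2 / (8 * t)) ≤ M.factorial * 2 ^ M * Real.exp (1 / 2) := by
  have h1 := Real.pow_div_factorial_le_exp ((1 + z) / 2) (by positivity) M
  rw [div_le_iff₀ (by positivity), div_pow, div_le_iff₀ (by positivity)] at h1
  have h2 : -t - z ^ 2 / (8 * t) ≤ -(z / 2) := by
    have h3 : t + z ^ 2 / (8 * t) - z / 2 = ((2 * t - z) ^ 2 + 4 * t ^ 2) / (8 * t) := by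
      field_simp
      ring
    have h4 : 0 ≤ ((2 * t - z) ^ 2 + 4 * t ^ 2) / (8 * t) :=
      div_nonneg (by nlinarith [sq_nonneg (2 * t - z), sq_nonneg t]) (by positivity)
    linarith
  calc (1 + z) ^ M * Real.exp (-t - z ^ 2 / (8 * t))
      ≤ (Real.exp ((1 + z) / 2) * M.factorial * 2 ^ M) * Real.exp (-(z / 2)) := by gcongr
    _ = M.factorial * 2 ^ M * (Real.exp ((1 + z) / 2) * Real.exp (-(z / 2))) := by ring
    _ = _ := by rw [← Real.exp_add]; ring_nf

/-- The operators `e^{-t(I-Δ)}` are uniformly bounded for the weighted supremum norm. -/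
theorem exists_norm_multiplierOp_exp_helmholtzSymbol_le (n : ℕ) :
    ∃ C, 1 ≤ C ∧ ∀ (g : 𝓢(EuclideanSpace ℝ (Fin n), ℂ)) (B : ℝ), 0 ≤ B →
      (∀ ξ, ‖g ξ‖ ≤ B * decayWeight n ξ) → ∀ t, 0 < t → ∀ ξ,
        ‖multiplierOp (fun x ↦ (Real.exp (-t * helmholtzSymbol x) : ℂ)) g ξ‖ ≤
          C * B * decayWeight n ξ := by
  set C1 : ℝ := (n + 1).factorial * 2 ^ (n + 1) * Real.exp (1 / 2)
  refine ⟨2 ^ (n / 2 : ℝ) * C1, ?_, ?_⟩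
  · have h1 : (1 : ℝ) ≤ 2 ^ (n / 2 : ℝ) := Real.one_le_rpow (by norm_num) (by positivity)
    have h2 : (1 : ℝ) ≤ (n + 1).factorial := by exact_mod_cast Nat.factorial_pos _
    have h3 : (1 : ℝ) ≤ 2 ^ (n + 1) := one_le_pow₀ (by norm_num)
    have h4 : (1 : ℝ) ≤ Real.exp (1 / 2) := Real.one_le_exp (by norm_num)
    exact one_le_mul_of_one_le_of_one_le h1
      (one_le_mul_of_one_le_of_one_le (one_le_mul_of_one_le_of_one_le h2 h3) h4)
  intro g B hB hg t ht ξ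
  have hpi := Real.pi_pos
  set b : ℝ := 4 * Real.pi ^ 2 * t with hb
  have hb0 : 0 < b := by positivity
  have e1 : multiplierOp (fun x ↦ (Real.exp (-t * helmholtzSymbol x) : ℂ)) g ξ =
      (Real.exp (-t) : ℂ) * 𝓕⁻ (fun x ↦ Complex.exp (-(b : ℂ) * (‖x‖ : ℂ) ^ 2) *
        𝓕 (g : EuclideanSpace ℝ (Fin n) → ℂ) x) ξ := by
    simp only [multiplierOp]
    rw [Real.fourierInv_eq', Real.fourierInv_eq', ← integral_const_mul]
    congr 1
    ext x
    have : (Real.exp (-t * helmholtzSymbol x) : ℂ) =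
        Real.exp (-t) * Complex.exp (-(b : ℂ) * (‖x‖ : ℂ) ^ 2) := by
      rw [Complex.ofReal_exp, Complex.ofReal_exp, ← Complex.exp_add]
      congr 1
      simp only [helmholtzSymbol, hb]
      push_cast
      ring
    rw [this]
    simp only [smul_eq_mul]
    ring
  rw [e1, fourierInv_gaussian_mul_fourier (by simpa using hb0) g.integrable]
  have e2 : ((Real.pi : ℂ) / b) ^ (Module.finrank ℝ (EuclideanSpace ℝ (Fin n)) / 2 : ℂ) =
      (((Real.pi / b) ^ (n / 2 : ℝ) : ℝ) : ℂ) := by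
    rw [Complex.ofReal_cpow (by positivity)]
    simp
  rw [e2, norm_mul, norm_mul, Complex.norm_real, Complex.norm_real,
    Real.norm_of_nonneg (by positivity), Real.norm_of_nonneg (by positivity)]
  have hint : Integrable (fun y : EuclideanSpace ℝ (Fin n) ↦
      Real.exp (-(1 / (8 * t)) * ‖ξ - y‖ ^ 2)) := by
    have h := (GaussianFourier.integrable_cexp_neg_mul_sq_norm_add
      (b := ((1 / (8 * t) : ℝ) : ℂ)) (by simpa using ht) 0 (0 : EuclideanSpace ℝ (Fin n))).norm
    refine (h.comp_sub_left ξ).congr (Filter.Eventually.of_forall fun y ↦ ?_)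
    simp only [Complex.norm_exp]
    congr 1
    norm_cast
    simp
  have hval : ∫ y : EuclideanSpace ℝ (Fin n), Real.exp (-(1 / (8 * t)) * ‖ξ - y‖ ^ 2) =
      (Real.pi / (1 / (8 * t))) ^ (n / 2 : ℝ) := by
    rw [integral_sub_left_eq_self (fun y : EuclideanSpace ℝ (Fin n) ↦
      Real.exp (-(1 / (8 * t)) * ‖y‖ ^ 2)), GaussianFourier.integral_rexp_neg_mul_sq_norm
      (by positivity)]
    simp
  have hpt : ∀ y, Real.exp (-t) * ‖g y * Complex.exp (-Real.pi ^ 2 * (‖ξ - y‖ : ℂ) ^ 2 / b)‖ ≤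
      (B * decayWeight n ξ * C1) * Real.exp (-(1 / (8 * t)) * ‖ξ - y‖ ^ 2) := by
    intro y
    have e3 : ‖Complex.exp (-Real.pi ^ 2 * (‖ξ - y‖ : ℂ) ^ 2 / b)‖ =
        Real.exp (-(‖ξ - y‖ ^ 2 / (4 * t))) := by
      rw [Complex.norm_exp]
      congr 1
      norm_cast
      rw [hb]
      field_simp
    rw [norm_mul, e3]
    have h1 := one_add_norm_pow_mul_exp_le ht (norm_nonneg (ξ - y)) (n + 1)
    -- Half of the Gaussian exponent, with e^{-t}, pays for moving the weight from y to ξ; the other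
    -- half is integrated. Doubling the variance is the source of the constant 2^{n/2}.
    have h2 : Real.exp (-t) * Real.exp (-(‖ξ - y‖ ^ 2 / (4 * t))) =
        Real.exp (-t - ‖ξ - y‖ ^ 2 / (8 * t)) * Real.exp (-(1 / (8 * t)) * ‖ξ - y‖ ^ 2) := by
      rw [← Real.exp_add, ← Real.exp_add]
      congr 1
      field_simp
      ring
    have hw := decayWeight_pos ξ
    calc _ = ‖g y‖ * (Real.exp (-t) * Real.exp (-(‖ξ - y‖ ^ 2 / (4 * t)))) := by ring
      _ ≤ (B * (decayWeight n ξ * (1 + ‖ξ - y‖) ^ (n + 1))) *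
          (Real.exp (-t - ‖ξ - y‖ ^ 2 / (8 * t)) *
            Real.exp (-(1 / (8 * t)) * ‖ξ - y‖ ^ 2)) := by
          rw [h2]
          gcongr
          exact (hg y).trans (by gcongr; exact decayWeight_le_mul ξ y)
      _ = (B * decayWeight n ξ * ((1 + ‖ξ - y‖) ^ (n + 1) *
          Real.exp (-t - ‖ξ - y‖ ^ 2 / (8 * t)))) *
            Real.exp (-(1 / (8 * t)) * ‖ξ - y‖ ^ 2) := by ring
      _ ≤ _ := by gcongr
  have hI : Real.exp (-t) * ‖∫ y, g y * Complex.exp (-Real.pi ^ 2 * (‖ξ - y‖ : ℂ) ^ 2 / b)‖ ≤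
      (B * decayWeight n ξ * C1) * (Real.pi / (1 / (8 * t))) ^ (n / 2 : ℝ) := by
    rw [← hval, ← integral_const_mul]
    refine (mul_le_mul_of_nonneg_left (norm_integral_le_integral_norm _)
      (Real.exp_pos _).le).trans ?_
    rw [← integral_const_mul]
    exact integral_mono_of_nonneg (Filter.Eventually.of_forall fun y ↦ by positivity)
      (hint.const_mul _) (Filter.Eventually.of_forall hpt)
  have e4 : (Real.pi / b) ^ (n / 2 : ℝ) * (Real.pi / (1 / (8 * t))) ^ (n / 2 : ℝ) =
      2 ^ (n / 2 : ℝ) := by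
    rw [← Real.mul_rpow (by positivity) (by positivity)]
    congr 1
    rw [hb]
    field_simp
    norm_num
  calc _ = (Real.pi / b) ^ (n / 2 : ℝ) * (Real.exp (-t) *
        ‖∫ y, g y * Complex.exp (-Real.pi ^ 2 * (‖ξ - y‖ : ℂ) ^ 2 / b)‖) := by ring
    _ ≤ (Real.pi / b) ^ (n / 2 : ℝ) * ((B * decayWeight n ξ * C1) *
        (Real.pi / (1 / (8 * t))) ^ (n / 2 : ℝ)) := by gcongr
    _ = ((Real.pi / b) ^ (n / 2 : ℝ) * (Real.pi / (1 / (8 * t))) ^ (n / 2 : ℝ)) *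
        (B * decayWeight n ξ * C1) := by ring
    _ = _ := by rw [e4]; ring

end Heat

/-! ### Multiplier operators and their superpositions. -/

section Multiplier

variable {n : ℕ}

theorem multiplierOp_apply (m : EuclideanSpace ℝ (Fin n) → ℂ)
    (f : 𝓢(EuclideanSpace ℝ (Fin n), ℂ)) (ξ : EuclideanSpace ℝ (Fin n)) :
    multiplierOp m f ξ = ∫ x, Complex.exp (((2 * Real.pi * inner ℝ x ξ : ℝ) : ℂ) * Complex.I) *
      (m x * (𝓕 f) x) := by
  rw [multiplierOp, Real.fourierInv_eq']
  rfl

theorem fourierMultiplierCLM_eq_multiplierOp {m : EuclideanSpace ℝ (Fin n) → ℂ}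
    (hm : m.HasTemperateGrowth) (f : 𝓢(EuclideanSpace ℝ (Fin n), ℂ)) :
    ⇑(SchwartzMap.fourierMultiplierCLM ℂ m f) = multiplierOp m f := by
  rw [SchwartzMap.fourierMultiplierCLM_apply, SchwartzMap.fourierInv_coe]
  have : ⇑(SchwartzMap.smulLeftCLM ℂ m (𝓕 f)) =
      fun x ↦ m x * 𝓕 (f : EuclideanSpace ℝ (Fin n) → ℂ) x := by
    ext x
    rw [SchwartzMap.smulLeftCLM_apply_apply hm]
    rfl
  rw [this, multiplierOp]

theorem multiplierOp_one (f : 𝓢(EuclideanSpace ℝ (Fin n), ℂ)) :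
    multiplierOp (fun _ ↦ 1) f = f := by
  rw [← fourierMultiplierCLM_eq_multiplierOp (by fun_prop)]
  simp

theorem integrable_multiplierOp_integrand {m : EuclideanSpace ℝ (Fin n) → ℂ}
    (hm : Continuous m) {B : ℝ} (hB : ∀ x, ‖m x‖ ≤ B) (f : 𝓢(EuclideanSpace ℝ (Fin n), ℂ))
    (ξ : EuclideanSpace ℝ (Fin n)) :
    Integrable (fun x ↦ Complex.exp (((2 * Real.pi * inner ℝ x ξ : ℝ) : ℂ) * Complex.I) *
      (m x * (𝓕 f) x)) := by
  refine ((𝓕 f).integrable (μ := volume) |>.norm.const_mul B).mono' ?_ ?_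
  · have := (𝓕 f).continuous
    exact Continuous.aestronglyMeasurable (by fun_prop)
  · refine Filter.Eventually.of_forall fun x ↦ ?_
    rw [norm_mul, Complex.norm_exp_ofReal_mul_I, one_mul, norm_mul]
    gcongr
    exact hB x

theorem multiplierOp_sub {m₁ m₂ : EuclideanSpace ℝ (Fin n) → ℂ} (h₁ : Continuous m₁)
    (h₂ : Continuous m₂) {B₁ B₂ : ℝ} (hB₁ : ∀ x, ‖m₁ x‖ ≤ B₁) (hB₂ : ∀ x, ‖m₂ x‖ ≤ B₂)
    (f : 𝓢(EuclideanSpace ℝ (Fin n), ℂ)) (ξ : EuclideanSpace ℝ (Fin n)) :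
    multiplierOp (fun x ↦ m₁ x - m₂ x) f ξ = multiplierOp m₁ f ξ - multiplierOp m₂ f ξ := by
  simp only [multiplierOp_apply]
  rw [← integral_sub (integrable_multiplierOp_integrand h₁ hB₁ f ξ)
    (integrable_multiplierOp_integrand h₂ hB₂ f ξ)]
  congr 1
  ext x
  ring

/-- Minkowski's inequality for a Fourier multiplier that is a superposition of multipliers. -/
theorem norm_multiplierOp_le_integral {ν : Measure ℝ} [SFinite ν]
    {k : ℝ → EuclideanSpace ℝ (Fin n) → ℝ} (hk : Measurable (Function.uncurry k))
    (hk0 : ∀ᵐ t ∂ν, ∀ x, 0 ≤ k t x) {κ : EuclideanSpace ℝ (Fin n) → ℝ}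
    (hki : ∀ x, Integrable (fun t ↦ k t x) ν) (hκ : ∀ x, ∫ t, k t x ∂ν = κ x)
    (f : 𝓢(EuclideanSpace ℝ (Fin n), ℂ)) (hf : Integrable (fun x ↦ κ x * ‖(𝓕 f) x‖))
    (ξ : EuclideanSpace ℝ (Fin n)) {B : ℝ → ℝ} (hB : Integrable B ν)
    (hkB : ∀ᵐ t ∂ν, ‖multiplierOp (fun x ↦ (k t x : ℂ)) f ξ‖ ≤ B t) :
    ‖multiplierOp (fun x ↦ (κ x : ℂ)) f ξ‖ ≤ ∫ t, B t ∂ν := by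
  set e : EuclideanSpace ℝ (Fin n) → ℂ := fun x ↦
    Complex.exp (((2 * Real.pi * inner ℝ x ξ : ℝ) : ℂ) * Complex.I) with he
  have hec : Continuous e := by fun_prop
  have hne : ∀ x, ‖e x‖ = 1 := fun x ↦ Complex.norm_exp_ofReal_mul_I _
  have hfc := (𝓕 f).continuous
  -- Because k ≥ 0, integrating the norm in t gives κ(x) times the norm of the transform of f, so
  -- `hf` is the absolute integrability that Fubini needs.
  have hint : Integrable (Function.uncurry fun (t : ℝ) (x : EuclideanSpace ℝ (Fin n)) ↦
      e x * ((k t x : ℂ) * (𝓕 f) x)) (ν.prod volume) := by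
    rw [integrable_prod_iff']
    · refine ⟨Filter.Eventually.of_forall fun x ↦ ?_, ?_⟩
      · have h1 : Integrable (fun t ↦ (k t x : ℂ)) ν := (hki x).ofReal
        have h2 : ∀ a b : ℂ, Integrable (fun t ↦ a * ((k t x : ℂ) * b)) ν :=
          fun a b ↦ (h1.mul_const b).const_mul a
        simp only [Function.uncurry_apply_pair]
        exact h2 _ _
      · refine hf.congr (Filter.Eventually.of_forall fun x ↦ ?_)
        simp only [Function.uncurry, norm_mul, hne, one_mul, Complex.norm_real]
        rw [integral_mul_const, ← hκ x]
        congr 1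
        refine integral_congr_ae ?_
        filter_upwards [hk0] with t ht
        rw [Real.norm_of_nonneg (ht x)]
    · refine Measurable.aestronglyMeasurable ?_
      have h1 : Measurable fun p : ℝ × EuclideanSpace ℝ (Fin n) ↦ k p.1 p.2 := hk
      exact ((hec.measurable.comp measurable_snd).mul ((Complex.measurable_ofReal.comp h1).mul
        (hfc.measurable.comp measurable_snd)))
  have heq : multiplierOp (fun x ↦ (κ x : ℂ)) f ξ =
      ∫ t, multiplierOp (fun x ↦ (k t x : ℂ)) f ξ ∂ν := by
    simp only [multiplierOp_apply]
    rw [integral_integral_swap hint]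
    congr 1
    ext x
    rw [integral_const_mul, integral_mul_const, integral_complex_ofReal, hκ]
  rw [heq]
  exact norm_integral_le_of_norm_le hB hkB

end Multiplier

/-! ### Power functions as integrals of 1 - e^{-tσ}. -/

section Subordination

/-- Used twice: with F(u) = 1 - e^{-u} it writes the symbol σ^θ as a superposition of heat symbols,
and with F(u) = min(1, u) it evaluates the resulting bound as a multiple of L^θ. -/
theorem integral_Ioi_rpow_mul_comp_mul (F : ℝ → ℝ) (θ : ℝ) {σ : ℝ} (hσ : 0 < σ) :
    ∫ t in Set.Ioi (0 : ℝ), t ^ (-θ - 1) * F (t * σ) =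
      σ ^ θ * ∫ t in Set.Ioi (0 : ℝ), t ^ (-θ - 1) * F t := by
  have h := integral_comp_mul_left_Ioi (fun u ↦ u ^ (-θ - 1) * F u) 0 hσ
  rw [mul_zero, smul_eq_mul] at h
  have h2 : ∫ t in Set.Ioi (0 : ℝ), (σ * t) ^ (-θ - 1) * F (σ * t) =
      σ ^ (-θ - 1) * ∫ t in Set.Ioi (0 : ℝ), t ^ (-θ - 1) * F (t * σ) := by
    rw [← integral_const_mul]
    refine setIntegral_congr_fun measurableSet_Ioi fun t ht ↦ ?_
    rw [Real.mul_rpow hσ.le (le_of_lt ht), mul_comm σ t]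
    ring
  rw [h2] at h
  have h3 : σ ^ θ * σ ^ (-θ - 1) = σ⁻¹ := by
    rw [← Real.rpow_add hσ, ← Real.rpow_neg_one]
    ring_nf
  have h4 : 0 < σ⁻¹ := by positivity
  have h5 : σ⁻¹ * ∫ t in Set.Ioi (0 : ℝ), t ^ (-θ - 1) * F (t * σ) =
      σ⁻¹ * (σ ^ θ * ∫ t in Set.Ioi (0 : ℝ), t ^ (-θ - 1) * F t) := by
    rw [← h3, mul_assoc, h, h3]; ring
  exact mul_left_cancel₀ h4.ne' h5

theorem integrableOn_Ioi_rpow_mul_comp_mul {F : ℝ → ℝ} {θ : ℝ} {σ : ℝ} (hσ : 0 < σ)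
    (hF : IntegrableOn (fun t ↦ t ^ (-θ - 1) * F t) (Set.Ioi 0)) :
    IntegrableOn (fun t ↦ t ^ (-θ - 1) * F (t * σ)) (Set.Ioi 0) := by
  have h := (integrableOn_Ioi_comp_mul_left_iff (fun u ↦ u ^ (-θ - 1) * F u) 0 hσ).2
    (by simpa using hF)
  refine IntegrableOn.congr_fun (h.const_mul ((σ ^ (-θ - 1))⁻¹)) (fun t ht ↦ ?_) measurableSet_Ioi
  have : 0 < σ ^ (-θ - 1) := by positivity
  rw [Real.mul_rpow hσ.le (le_of_lt ht), mul_comm σ t]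
  field_simp

/-- The integrand is t^{-θ} near 0, which needs θ < 1, and t^{-θ-1} at infinity, which needs θ > 0.
-/
theorem integrableOn_Ioi_rpow_mul_min {θ : ℝ} (h0 : 0 < θ) (h1 : θ < 1) :
    IntegrableOn (fun t : ℝ ↦ t ^ (-θ - 1) * min 1 t) (Set.Ioi 0) := by
  rw [← Set.Ioc_union_Ioi_eq_Ioi (zero_le_one (α := ℝ))]
  refine IntegrableOn.union ?_ ?_
  · have h := (intervalIntegrable_iff_integrableOn_Ioc_of_le zero_le_one).1
      (intervalIntegral.intervalIntegrable_rpow' (a := 0) (b := 1) (r := -θ) (by linarith))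
    refine h.congr_fun (fun t ht ↦ ?_) measurableSet_Ioc
    simp only
    rw [min_eq_right ht.2, Real.rpow_sub_one ht.1.ne']
    have := ht.1
    field_simp
  · have h := integrableOn_Ioi_rpow_of_lt (a := -θ - 1) (by linarith) zero_lt_one
    refine h.congr_fun (fun t ht ↦ ?_) measurableSet_Ioi
    simp only
    rw [min_eq_left (le_of_lt ht), mul_one]

theorem one_sub_exp_neg_le_min {t : ℝ} : 1 - Real.exp (-t) ≤ min 1 t :=
  le_min (by linarith [Real.exp_pos (-t)]) (by linarith [Real.add_one_le_exp (-t)])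

theorem integrableOn_Ioi_rpow_mul_one_sub_exp {θ : ℝ} (h0 : 0 < θ) (h1 : θ < 1) :
    IntegrableOn (fun t : ℝ ↦ t ^ (-θ - 1) * (1 - Real.exp (-t))) (Set.Ioi 0) := by
  refine (integrableOn_Ioi_rpow_mul_min h0 h1).mono' ?_ ?_
  · refine ContinuousOn.aestronglyMeasurable ?_ measurableSet_Ioi
    refine ContinuousOn.mul (fun t ht ↦ ?_) (by fun_prop)
    exact (Real.continuousAt_rpow_const _ _ (Or.inl (ne_of_gt ht))).continuousWithinAt
  · refine (ae_restrict_iff' measurableSet_Ioi).2 (Filter.Eventually.of_forall fun t ht ↦ ?_)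
    have ht' : (0 : ℝ) < t := ht
    have h2 : 0 ≤ 1 - Real.exp (-t) := by
      have := Real.exp_le_one_iff.2 (by linarith : -t ≤ 0)
      linarith
    rw [Real.norm_of_nonneg (by positivity)]
    gcongr
    exact one_sub_exp_neg_le_min

theorem integral_Ioi_rpow_mul_one_sub_exp_pos {θ : ℝ} (h0 : 0 < θ) (h1 : θ < 1) :
    0 < ∫ t in Set.Ioi (0 : ℝ), t ^ (-θ - 1) * (1 - Real.exp (-t)) := by
  have hpos : ∀ t ∈ Set.Ioi (0 : ℝ), 0 < t ^ (-θ - 1) * (1 - Real.exp (-t)) := by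
    intro t ht
    have ht' : (0 : ℝ) < t := ht
    have : Real.exp (-t) < 1 := by simpa using ht'
    have h2 : 0 < 1 - Real.exp (-t) := by linarith
    positivity
  rw [setIntegral_pos_iff_support_of_nonneg_ae
    ((ae_restrict_iff' measurableSet_Ioi).2 (Filter.Eventually.of_forall fun t ht ↦ (hpos t ht).le))
    (integrableOn_Ioi_rpow_mul_one_sub_exp h0 h1)]
  have : Function.support (fun t : ℝ ↦ t ^ (-θ - 1) * (1 - Real.exp (-t))) ∩ Set.Ioi 0 =
      Set.Ioi 0 := Set.inter_eq_right.2 fun t ht ↦ (hpos t ht).ne'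
  rw [this]
  simp

end Subordination

/-! ### Fractional powers of I - Δ by interpolation. -/

section Fractional

variable {n : ℕ}

theorem integrable_helmholtzSymbol_rpow_mul (s : ℝ) (g : 𝓢(EuclideanSpace ℝ (Fin n), ℂ)) :
    Integrable (fun x ↦ helmholtzSymbol x ^ (s / 2) * ‖(𝓕 g) x‖) := by
  have h := (SchwartzMap.smulLeftCLM ℂ (besselSymbol n s) (𝓕 g)).integrable (μ := volume)
  refine h.norm.congr (Filter.Eventually.of_forall fun x ↦ ?_)
  simp only
  rw [SchwartzMap.smulLeftCLM_apply_apply (besselSymbol_hasTemperateGrowth n s), norm_smul,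
    besselSymbol, Complex.norm_real, Real.norm_of_nonneg (by positivity)]
  rfl

/-- Here g' is (I - Δ)g. The bound without t is the triangle inequality and the uniform heat bound.
The bound tL comes from 1 - e^{-tσ} = ∫₀ᵗ σe^{-τσ} dτ, the factor σ being absorbed into g'. -/
theorem exists_norm_multiplierOp_one_sub_exp_le (n : ℕ) :
    ∃ C, 0 ≤ C ∧ ∀ (g g' : 𝓢(EuclideanSpace ℝ (Fin n), ℂ)),
      (∀ x, (𝓕 g') x = (helmholtzSymbol x : ℂ) * (𝓕 g) x) → ∀ (B L : ℝ), 0 ≤ B → 0 ≤ L →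
      (∀ ξ, ‖g ξ‖ ≤ B * decayWeight n ξ) → (∀ ξ, ‖g' ξ‖ ≤ B * L * decayWeight n ξ) →
      ∀ t, 0 < t → ∀ ξ,
        ‖multiplierOp (fun x ↦ ((1 - Real.exp (-(t * helmholtzSymbol x)) : ℝ) : ℂ)) g ξ‖ ≤
          C * B * decayWeight n ξ * min 1 (t * L) := by
  obtain ⟨C, hC1, hC⟩ := exists_norm_multiplierOp_exp_helmholtzSymbol_le n
  refine ⟨1 + C, by linarith, fun g g' hgg' B L hB hL hg hg' t ht ξ ↦ ?_⟩
  have hσ := fun x : EuclideanSpace ℝ (Fin n) ↦ one_le_helmholtzSymbol x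
  have hσc := continuous_helmholtzSymbol n
  have hw := decayWeight_pos ξ
  have hBw : 0 ≤ B * decayWeight n ξ := by positivity
  rw [mul_min_of_nonneg _ _ (by positivity)]
  refine le_min ?_ ?_
  · have hexp : ∀ x : EuclideanSpace ℝ (Fin n),
        ‖((Real.exp (-t * helmholtzSymbol x) : ℝ) : ℂ)‖ ≤ 1 := by
      intro x
      rw [Complex.norm_real, Real.norm_of_nonneg (Real.exp_pos _).le, Real.exp_le_one_iff]
      nlinarith [hσ x]
    have e : (fun x : EuclideanSpace ℝ (Fin n) ↦
        ((1 - Real.exp (-(t * helmholtzSymbol x)) : ℝ) : ℂ)) =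
        fun x ↦ 1 - ((Real.exp (-t * helmholtzSymbol x) : ℝ) : ℂ) := by
      ext x
      push_cast
      ring_nf
    rw [e, multiplierOp_sub (B₁ := 1) (B₂ := 1) (by fun_prop) (by fun_prop) (by simp) hexp,
      multiplierOp_one]
    refine (norm_sub_le _ _).trans ?_
    have h1 := hg ξ
    have h2 := hC g B hB hg t ht ξ
    nlinarith
  · have hB' : ∀ᵐ τ ∂(volume.restrict (Set.Ioc 0 t)),
        ‖multiplierOp (fun x ↦ ((helmholtzSymbol x * Real.exp (-τ * helmholtzSymbol x) : ℝ) : ℂ))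
          g ξ‖ ≤ C * (B * L) * decayWeight n ξ := by
      refine (ae_restrict_iff' measurableSet_Ioc).2 (Filter.Eventually.of_forall fun τ hτ ↦ ?_)
      have h := hC g' (B * L) (by positivity) hg' τ hτ.1 ξ
      convert h using 2
      simp only [multiplierOp_apply]
      congr 1
      ext x
      rw [hgg' x]
      push_cast
      ring
    have hkey := norm_multiplierOp_le_integral (ν := volume.restrict (Set.Ioc 0 t))
      (k := fun τ x ↦ helmholtzSymbol x * Real.exp (-τ * helmholtzSymbol x))
      (κ := fun x ↦ 1 - Real.exp (-(t * helmholtzSymbol x)))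
      (by
        refine Continuous.measurable ?_
        have : Continuous fun p : ℝ × EuclideanSpace ℝ (Fin n) ↦
          helmholtzSymbol p.2 * Real.exp (-p.1 * helmholtzSymbol p.2) := by fun_prop
        exact this)
      (Filter.Eventually.of_forall fun τ x ↦
        mul_nonneg (zero_le_one.trans (hσ x)) (Real.exp_pos _).le)
      (fun x ↦ by
        have : Continuous fun τ : ℝ ↦
          helmholtzSymbol x * Real.exp (-τ * helmholtzSymbol x) := by fun_prop
        exact this.integrableOn_Ioc)
      (fun x ↦ by
        rw [← intervalIntegral.integral_of_le ht.le]
        rw [intervalIntegral.integral_eq_sub_of_hasDerivAt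
          (f := fun τ ↦ -Real.exp (-τ * helmholtzSymbol x))]
        · simp
          ring
        · intro τ _
          have h1 : HasDerivAt (fun τ : ℝ ↦ -τ * helmholtzSymbol x) (-1 * helmholtzSymbol x) τ :=
            (hasDerivAt_neg τ).mul_const _
          have h2 : helmholtzSymbol x * Real.exp (-τ * helmholtzSymbol x) =
              -(Real.exp (-τ * helmholtzSymbol x) * (-1 * helmholtzSymbol x)) := by ring
          rw [h2]
          exact h1.exp.neg
        · have : Continuous fun τ : ℝ ↦
            helmholtzSymbol x * Real.exp (-τ * helmholtzSymbol x) := by fun_prop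
          exact this.intervalIntegrable _ _)
      g (by
        refine ((𝓕 g).integrable (μ := volume)).norm.mono' ?_ ?_
        · have := (𝓕 g).continuous
          exact Continuous.aestronglyMeasurable (by fun_prop)
        · refine Filter.Eventually.of_forall fun x ↦ ?_
          have h1 : Real.exp (-(t * helmholtzSymbol x)) ≤ 1 :=
            Real.exp_le_one_iff.2 (by nlinarith [hσ x])
          have h2 := Real.exp_pos (-(t * helmholtzSymbol x))
          rw [norm_mul, norm_norm, Real.norm_of_nonneg (by linarith)]
          exact mul_le_of_le_one_left (norm_nonneg _) (by linarith))
      ξ (B := fun _ ↦ C * (B * L) * decayWeight n ξ) (integrable_const _) hB'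
    refine hkey.trans ?_
    rw [integral_const]
    simp only [MeasurableSet.univ, measureReal_restrict_apply, Set.univ_inter, Real.volume_real_Ioc,
      sub_zero, smul_eq_mul, max_eq_left ht.le]
    have : 0 ≤ t * L * (B * decayWeight n ξ) := by positivity
    nlinarith

/-- Interpolation between `I` and `I - Δ` for the weighted supremum norm. -/
theorem exists_norm_multiplierOp_besselSymbol_le (n : ℕ) {θ : ℝ} (h0 : 0 < θ) (h1 : θ < 1) :
    ∃ C, 0 ≤ C ∧ ∀ (g g' : 𝓢(EuclideanSpace ℝ (Fin n), ℂ)),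
      (∀ x, (𝓕 g') x = (helmholtzSymbol x : ℂ) * (𝓕 g) x) → ∀ (B L : ℝ), 0 ≤ B → 0 < L →
      (∀ ξ, ‖g ξ‖ ≤ B * decayWeight n ξ) → (∀ ξ, ‖g' ξ‖ ≤ B * L * decayWeight n ξ) →
      ∀ ξ, ‖multiplierOp (besselSymbol n (2 * θ)) g ξ‖ ≤ C * B * L ^ θ * decayWeight n ξ := by
  obtain ⟨C, hC0, hC⟩ := exists_norm_multiplierOp_one_sub_exp_le n
  set c := ∫ t in Set.Ioi (0 : ℝ), t ^ (-θ - 1) * (1 - Real.exp (-t)) with hc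
  have hcpos : 0 < c := integral_Ioi_rpow_mul_one_sub_exp_pos h0 h1
  set d := ∫ t in Set.Ioi (0 : ℝ), t ^ (-θ - 1) * min 1 t with hd
  have hd0 : 0 ≤ d := setIntegral_nonneg measurableSet_Ioi fun t ht ↦ by
    have ht' : (0 : ℝ) < t := ht
    positivity
  refine ⟨c⁻¹ * (C * d), by positivity, fun g g' hgg' B L hB hL hg hg' ξ ↦ ?_⟩
  have hσ := fun x : EuclideanSpace ℝ (Fin n) ↦
    zero_lt_one.trans_le (one_le_helmholtzSymbol x)
  have hσc := continuous_helmholtzSymbol n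
  have hw := decayWeight_pos ξ
  have hBessel : besselSymbol n (2 * θ) = fun x ↦ ((helmholtzSymbol x ^ θ : ℝ) : ℂ) := by
    ext x
    rw [besselSymbol, mul_div_cancel_left₀ _ two_ne_zero]
    rfl
  -- Subordination: σ^θ = c⁻¹ ∫₀^∞ t^{-θ-1}(1 - e^{-tσ}) dt, with the bound min(1, tL) inserted for
  -- each t.
  have hkey := norm_multiplierOp_le_integral (ν := volume.restrict (Set.Ioi 0))
      (k := fun t x ↦ c⁻¹ * (t ^ (-θ - 1) * (1 - Real.exp (-(t * helmholtzSymbol x)))))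
      (κ := fun x ↦ helmholtzSymbol x ^ θ)
      (by
        have h2 : Measurable fun p : ℝ × EuclideanSpace ℝ (Fin n) ↦
            Real.exp (-(p.1 * helmholtzSymbol p.2)) := by
          refine Continuous.measurable ?_
          fun_prop
        have h3 : Measurable fun p : ℝ × EuclideanSpace ℝ (Fin n) ↦
            c⁻¹ * (p.1 ^ (-θ - 1) * (1 - Real.exp (-(p.1 * helmholtzSymbol p.2)))) :=
          ((measurable_fst.pow_const _).mul (measurable_const.sub h2)).const_mul _
        exact h3)
      ((ae_restrict_iff' measurableSet_Ioi).2 (Filter.Eventually.of_forall fun t ht x ↦ by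
        have ht' : (0 : ℝ) < t := ht
        have h2 : Real.exp (-(t * helmholtzSymbol x)) ≤ 1 :=
          Real.exp_le_one_iff.2 (by nlinarith [hσ x])
        have h3 : 0 ≤ 1 - Real.exp (-(t * helmholtzSymbol x)) := by linarith
        positivity))
      (fun x ↦ (integrableOn_Ioi_rpow_mul_comp_mul (F := fun u ↦ 1 - Real.exp (-u)) (hσ x)
        (integrableOn_Ioi_rpow_mul_one_sub_exp h0 h1)).const_mul _)
      (fun x ↦ by
        rw [integral_const_mul,
          integral_Ioi_rpow_mul_comp_mul (fun u ↦ 1 - Real.exp (-u)) θ (hσ x), ← hc]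
        field_simp)
      g (by simpa using integrable_helmholtzSymbol_rpow_mul (2 * θ) g)
      ξ (B := fun t ↦ c⁻¹ * (C * B * decayWeight n ξ) * (t ^ (-θ - 1) * min 1 (t * L)))
      ((integrableOn_Ioi_rpow_mul_comp_mul (F := fun u ↦ min 1 u) hL
        (integrableOn_Ioi_rpow_mul_min h0 h1)).const_mul _)
      ((ae_restrict_iff' measurableSet_Ioi).2 (Filter.Eventually.of_forall fun t ht ↦ by
        have ht' : (0 : ℝ) < t := ht
        have h2 := hC g g' hgg' B L hB hL.le hg hg' t ht' ξ
        have h3 : multiplierOp (fun x ↦ ((c⁻¹ * (t ^ (-θ - 1) *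
            (1 - Real.exp (-(t * helmholtzSymbol x)))) : ℝ) : ℂ)) g ξ =
            ((c⁻¹ * t ^ (-θ - 1) : ℝ) : ℂ) *
              multiplierOp (fun x ↦ ((1 - Real.exp (-(t * helmholtzSymbol x)) : ℝ) : ℂ)) g ξ := by
          simp only [multiplierOp_apply]
          rw [← integral_const_mul]
          congr 1
          ext x
          push_cast
          ring
        rw [h3, norm_mul, Complex.norm_real, Real.norm_of_nonneg (by positivity)]
        calc _ ≤ c⁻¹ * t ^ (-θ - 1) * (C * B * decayWeight n ξ * min 1 (t * L)) := by gcongr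
          _ = _ := by ring))
  rw [hBessel]
  refine hkey.trans (le_of_eq ?_)
  rw [integral_const_mul, integral_Ioi_rpow_mul_comp_mul (fun u ↦ min 1 u) θ hL, ← hd]
  ring

end Fractional

/-! ### Chirps and the action of I - Δ on them. -/

section Chirp

variable {n : ℕ}

theorem hasTemperateGrowth_cexp_mul_I :
    (fun u : ℝ ↦ Complex.exp (u * Complex.I)).HasTemperateGrowth := by
  have hder : ∀ k : ℕ, iteratedDeriv k (fun u : ℝ ↦ Complex.exp (u * Complex.I)) =
      fun u : ℝ ↦ Complex.I ^ k * Complex.exp (u * Complex.I) := by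
    intro k
    induction k with
    | zero => simp
    | succ k ih =>
      rw [iteratedDeriv_succ, ih]
      ext u
      have h1 : HasDerivAt (fun u : ℝ ↦ (u : ℂ) * Complex.I) (1 * Complex.I) u :=
        (Complex.ofRealCLM.hasDerivAt).mul_const _
      rw [(h1.cexp.const_mul (Complex.I ^ k)).deriv]
      ring
  have hc : ContDiff ℝ ∞ fun u : ℝ ↦ (u : ℂ) := Complex.ofRealCLM.contDiff
  refine ⟨(hc.mul contDiff_const).cexp, fun k ↦ ⟨0, 1, fun u ↦ ?_⟩⟩
  rw [norm_iteratedFDeriv_eq_norm_iteratedDeriv, hder]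
  simp [Complex.norm_exp_ofReal_mul_I]

/-- The quadratic oscillation `e^{iλ|ξ|²}`. -/
noncomputable def chirp (l : ℝ) (ξ : EuclideanSpace ℝ (Fin n)) : ℂ :=
  Complex.exp (((l * ‖ξ‖ ^ 2 : ℝ) : ℂ) * Complex.I)

theorem chirp_hasTemperateGrowth (l : ℝ) :
    (chirp l : EuclideanSpace ℝ (Fin n) → ℂ).HasTemperateGrowth := by
  have h : (fun ξ : EuclideanSpace ℝ (Fin n) ↦ l * ‖ξ‖ ^ 2).HasTemperateGrowth := by fun_prop
  exact hasTemperateGrowth_cexp_mul_I.comp h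

theorem norm_chirp (l : ℝ) (ξ : EuclideanSpace ℝ (Fin n)) : ‖chirp l ξ‖ = 1 :=
  Complex.norm_exp_ofReal_mul_I _

/-- The Schwartz function `e^{iλ|ξ|²} a(ξ)`. -/
noncomputable def chirpMul (l : ℝ) :
    𝓢(EuclideanSpace ℝ (Fin n), ℂ) →L[ℂ] 𝓢(EuclideanSpace ℝ (Fin n), ℂ) :=
  SchwartzMap.smulLeftCLM ℂ (chirp l)

theorem chirpMul_apply (l : ℝ) (a : 𝓢(EuclideanSpace ℝ (Fin n), ℂ))
    (ξ : EuclideanSpace ℝ (Fin n)) : chirpMul l a ξ = chirp l ξ * a ξ := by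
  rw [chirpMul, SchwartzMap.smulLeftCLM_apply_apply (chirp_hasTemperateGrowth l)]
  rfl

theorem norm_chirpMul_apply (l : ℝ) (a : 𝓢(EuclideanSpace ℝ (Fin n), ℂ))
    (ξ : EuclideanSpace ℝ (Fin n)) : ‖chirpMul l a ξ‖ = ‖a ξ‖ := by
  rw [chirpMul_apply, norm_mul, norm_chirp, one_mul]

/-- Multiplication by `2i⟨ξ, v⟩`. -/
noncomputable def linearMul (v : EuclideanSpace ℝ (Fin n)) :
    𝓢(EuclideanSpace ℝ (Fin n), ℂ) →L[ℂ] 𝓢(EuclideanSpace ℝ (Fin n), ℂ) :=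
  SchwartzMap.smulLeftCLM ℂ (fun ξ ↦ 2 * Complex.I * ((inner ℝ ξ v : ℝ) : ℂ))

theorem linearMul_apply (v : EuclideanSpace ℝ (Fin n)) (a : 𝓢(EuclideanSpace ℝ (Fin n), ℂ))
    (ξ : EuclideanSpace ℝ (Fin n)) :
    linearMul v a ξ = 2 * Complex.I * ((inner ℝ ξ v : ℝ) : ℂ) * a ξ := by
  rw [linearMul, SchwartzMap.smulLeftCLM_apply_apply (by fun_prop)]
  rfl

open LineDeriv Laplacian

/-- The derivative of the chirp along v is 2iλ⟨ξ, v⟩ times the chirp, so each derivative costs one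
power of λ and leaves the chirp as a factor. -/
theorem lineDerivOp_chirpMul (l : ℝ) (v : EuclideanSpace ℝ (Fin n))
    (a : 𝓢(EuclideanSpace ℝ (Fin n), ℂ)) :
    ∂_{v} (chirpMul l a) = chirpMul l (∂_{v} a + (l : ℂ) • linearMul v a) := by
  ext ξ
  rw [SchwartzMap.lineDerivOp_apply_eq_fderiv, chirpMul_apply]
  have h1 : HasFDerivAt (fun ξ : EuclideanSpace ℝ (Fin n) ↦ ((l * ‖ξ‖ ^ 2 : ℝ) : ℂ) * Complex.I)
      (Complex.I • Complex.ofRealCLM.comp (l • (2 • (innerSL ℝ ξ).comp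
        (ContinuousLinearMap.id ℝ _)))) ξ :=
    ((Complex.ofRealCLM.hasFDerivAt.comp ξ ((hasFDerivAt_id ξ).norm_sq.const_mul l))).mul_const _
  have h2 := h1.cexp.mul (SchwartzMap.hasFDerivAt a ξ)
  have h3 : ⇑(chirpMul l a) = fun ξ ↦ Complex.exp (((l * ‖ξ‖ ^ 2 : ℝ) : ℂ) * Complex.I) * a ξ := by
    ext ξ
    rw [chirpMul_apply]
    rfl
  rw [h3]
  have h4 := h2.fderiv
  erw [h4]
  simp only [_root_.add_apply, _root_.smul_apply, linearMul_apply,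
    SchwartzMap.lineDerivOp_apply_eq_fderiv, chirp]
  simp [real_inner_comm]
  ring

theorem fourierMultiplierCLM_besselSymbol_two (f : 𝓢(EuclideanSpace ℝ (Fin n), ℂ)) :
    SchwartzMap.fourierMultiplierCLM ℂ (besselSymbol n 2) f = f - Δ f := by
  rw [SchwartzMap.laplacian_eq_fourierMultiplierCLM,
    ← SchwartzMap.fourierMultiplierCLM_ofReal ℂ (by fun_prop)]
  have h1 : f = SchwartzMap.fourierMultiplierCLM ℂ (fun _ ↦ (1 : ℂ)) f := by simp
  conv_rhs => enter [1]; rw [h1]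
  simp only [SchwartzMap.fourierMultiplierCLM_apply]
  rw [← FourierTransform.fourierInv_smul, sub_eq_add_neg,
    ← neg_one_smul ℂ (𝓕⁻ _), ← FourierTransform.fourierInv_smul, ← FourierTransform.fourierInv_add]
  congr 1
  ext x
  simp only [_root_.add_apply, _root_.smul_apply]
  rw [SchwartzMap.smulLeftCLM_apply_apply (besselSymbol_hasTemperateGrowth n 2),
    SchwartzMap.smulLeftCLM_apply_apply (by fun_prop),
    SchwartzMap.smulLeftCLM_apply_apply (by fun_prop)]
  simp [besselSymbol]
  ring

/-- Applying `I - Δ` to `e^{iλ|ξ|²} a(ξ)` produces a quadratic polynomial in `λ`. -/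
theorem exists_besselSymbol_two_chirpMul (a : 𝓢(EuclideanSpace ℝ (Fin n), ℂ)) :
    ∃ a₀ a₁ a₂ : 𝓢(EuclideanSpace ℝ (Fin n), ℂ), ∀ l : ℝ,
      SchwartzMap.fourierMultiplierCLM ℂ (besselSymbol n 2) (chirpMul l a) =
        chirpMul l (a₀ + (l : ℂ) • a₁ + ((l ^ 2 : ℝ) : ℂ) • a₂) := by
  set b := EuclideanSpace.basisFun (Fin n) ℝ
  refine ⟨a - ∑ i, ∂_{b i} (∂_{b i} a), -∑ i, (∂_{b i} (linearMul (b i) a) +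
    linearMul (b i) (∂_{b i} a)), -∑ i, linearMul (b i) (linearMul (b i) a), fun l ↦ ?_⟩
  rw [fourierMultiplierCLM_besselSymbol_two, SchwartzMap.laplacian_eq_sum b]
  have : ∀ i, ∂_{b i} (∂_{b i} (chirpMul l a)) = chirpMul l (∂_{b i} (∂_{b i} a) +
      (l : ℂ) • (∂_{b i} (linearMul (b i) a) + linearMul (b i) (∂_{b i} a)) +
      ((l ^ 2 : ℝ) : ℂ) • linearMul (b i) (linearMul (b i) a)) := by
    intro i
    rw [lineDerivOp_chirpMul, lineDerivOp_chirpMul]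
    congr 1
    rw [lineDerivOp_add, lineDerivOp_smul, map_add, map_smul, smul_add, smul_smul, smul_add]
    push_cast
    rw [pow_two]
    abel
  simp_rw [this]
  rw [← map_sum, ← map_sub]
  congr 1
  simp only [Finset.sum_add_distrib, ← Finset.smul_sum, smul_neg, smul_add]
  abel

end Chirp

/-! ### The Bessel operator on chirps. -/

section SobolevBound

variable {n : ℕ}

theorem besselSymbol_two_eq (x : EuclideanSpace ℝ (Fin n)) :
    besselSymbol n 2 x = (helmholtzSymbol x : ℂ) := by
  simp [besselSymbol, helmholtzSymbol]

theorem besselSymbol_mul (s t : ℝ) :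
    besselSymbol n s * besselSymbol n t = besselSymbol n (s + t) := by
  ext x
  have : 0 < 1 + 4 * Real.pi ^ 2 * ‖x‖ ^ 2 := by positivity
  simp only [Pi.mul_apply, besselSymbol]
  rw [← Complex.ofReal_mul, ← Real.rpow_add this, add_div]

theorem fourier_fourierMultiplierCLM_apply {m : EuclideanSpace ℝ (Fin n) → ℂ}
    (hm : m.HasTemperateGrowth) (f : 𝓢(EuclideanSpace ℝ (Fin n), ℂ))
    (x : EuclideanSpace ℝ (Fin n)) :
    (𝓕 (SchwartzMap.fourierMultiplierCLM ℂ m f)) x = m x * (𝓕 f) x := by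
  rw [SchwartzMap.fourierMultiplierCLM_apply, FourierTransform.fourier_fourierInv_eq,
    SchwartzMap.smulLeftCLM_apply_apply hm]
  rfl

/-- `(I - Δ)^{s/2}` costs at most `λ^s` on the chirps `e^{iλ|ξ|²} a(ξ)`. -/
theorem exists_norm_besselSymbol_chirpMul_le {s : ℝ} (hs : 0 ≤ s)
    (a : 𝓢(EuclideanSpace ℝ (Fin n), ℂ)) :
    ∃ C, 0 ≤ C ∧ ∀ l : ℝ, 0 ≤ l → ∀ ξ,
      ‖SchwartzMap.fourierMultiplierCLM ℂ (besselSymbol n s) (chirpMul l a) ξ‖ ≤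
        C * (1 + l) ^ s * decayWeight n ξ := by
  have hpoly : ∀ (C₀ C₁ C₂ s l : ℝ), 0 ≤ C₀ → 0 ≤ C₁ → 0 ≤ C₂ → 0 ≤ l →
      C₀ * (1 + l) ^ s + l * (C₁ * (1 + l) ^ s) + l ^ 2 * (C₂ * (1 + l) ^ s) ≤
        (C₀ + C₁ + C₂) * (1 + l) ^ (s + 2) := by
    intro C₀ C₁ C₂ s l h0 h1 h2 hl
    rw [Real.rpow_add (by positivity), Real.rpow_two]
    have h3 : 0 ≤ (1 + l) ^ s := by positivity
    have h4 : C₀ + l * C₁ + l ^ 2 * C₂ ≤ (C₀ + C₁ + C₂) * (1 + l) ^ 2 := by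
      nlinarith [mul_nonneg h0 hl, mul_nonneg h1 hl, mul_nonneg h2 hl,
        mul_nonneg h0 (sq_nonneg l), mul_nonneg h1 (sq_nonneg l)]
    nlinarith
  -- Induction on k peels off whole powers of I - Δ, each replacing the amplitude a by a quadratic
  -- polynomial in λ; interpolation handles the remaining fractional power θ < 1.
  obtain ⟨k, θ, hθ0, hθ1, rfl⟩ : ∃ (k : ℕ) (θ : ℝ), 0 ≤ θ ∧ θ < 1 ∧ s = 2 * θ + 2 * k := by
    refine ⟨⌊s / 2⌋₊, s / 2 - ⌊s / 2⌋₊, ?_, ?_, by ring⟩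
    · linarith [Nat.floor_le (by positivity : 0 ≤ s / 2)]
    · linarith [Nat.lt_floor_add_one (s / 2)]
  clear hs
  induction k generalizing a with
  | zero =>
    obtain ⟨Ca, hCa0, hCa⟩ := a.exists_norm_le_decayWeight
    rcases hθ0.eq_or_lt with rfl | hθ0
    · refine ⟨Ca, hCa0, fun l hl ξ ↦ ?_⟩
      have h0 : besselSymbol n (2 * 0 + 2 * (0 : ℕ)) = fun _ ↦ 1 := by
        ext x
        simp [besselSymbol]
      rw [h0]
      simpa [norm_chirpMul_apply] using hCa ξ
    · obtain ⟨C, hC0, hC⟩ := exists_norm_multiplierOp_besselSymbol_le n hθ0 hθ1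
      obtain ⟨a₀, a₁, a₂, ha⟩ := exists_besselSymbol_two_chirpMul a
      obtain ⟨C₀, hC₀0, hC₀⟩ := a₀.exists_norm_le_decayWeight
      obtain ⟨C₁, hC₁0, hC₁⟩ := a₁.exists_norm_le_decayWeight
      obtain ⟨C₂, hC₂0, hC₂⟩ := a₂.exists_norm_le_decayWeight
      refine ⟨C * (Ca + (C₀ + C₁ + C₂)), by positivity, fun l hl ξ ↦ ?_⟩
      have h := hC (chirpMul l a)
        (SchwartzMap.fourierMultiplierCLM ℂ (besselSymbol n 2) (chirpMul l a))
        (fun x ↦ by rw [fourier_fourierMultiplierCLM_apply (besselSymbol_hasTemperateGrowth n 2),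
          besselSymbol_two_eq])
        -- Here L = (1+λ)², the cost of one I - Δ, so that L^θ = (1+λ)^{2θ}.
        (Ca + (C₀ + C₁ + C₂)) ((1 + l) ^ 2) (by positivity) (by positivity)
        (fun ξ ↦ by
          rw [norm_chirpMul_apply]
          have hw := (decayWeight_pos ξ).le
          refine (hCa ξ).trans ?_
          gcongr
          linarith)
        (fun ξ ↦ by
          have hw := decayWeight_pos ξ
          rw [ha, norm_chirpMul_apply]
          simp only [_root_.add_apply, _root_.smul_apply]
          refine (norm_add₃_le).trans ?_
          rw [norm_smul, norm_smul, Complex.norm_real, Complex.norm_real, Real.norm_of_nonneg hl,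
            Real.norm_of_nonneg (sq_nonneg l)]
          have h1 := hpoly C₀ C₁ C₂ 0 l hC₀0 hC₁0 hC₂0 hl
          simp only [Real.rpow_zero, mul_one, zero_add, Real.rpow_two] at h1
          calc _ ≤ C₀ * decayWeight n ξ + l * (C₁ * decayWeight n ξ) +
                l ^ 2 * (C₂ * decayWeight n ξ) := by
                gcongr
                exacts [hC₀ ξ, hC₁ ξ, hC₂ ξ]
            _ = (C₀ + l * C₁ + l ^ 2 * C₂) * decayWeight n ξ := by ring
            _ ≤ ((C₀ + C₁ + C₂) * (1 + l) ^ 2) * decayWeight n ξ := by gcongr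
            _ ≤ _ := by
                refine mul_le_mul_of_nonneg_right ?_ hw.le
                refine mul_le_mul_of_nonneg_right ?_ (by positivity)
                linarith) ξ
      rw [fourierMultiplierCLM_eq_multiplierOp (besselSymbol_hasTemperateGrowth n _)]
      have e : ((1 + l) ^ 2) ^ θ = (1 + l) ^ (2 * θ + 2 * ((0 : ℕ) : ℝ)) := by
        rw [← Real.rpow_two, ← Real.rpow_mul (by positivity)]
        simp
      rw [← e]
      simpa using h
  | succ k ih =>
    obtain ⟨a₀, a₁, a₂, ha⟩ := exists_besselSymbol_two_chirpMul a
    obtain ⟨C₀, hC₀0, hC₀⟩ := ih a₀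
    obtain ⟨C₁, hC₁0, hC₁⟩ := ih a₁
    obtain ⟨C₂, hC₂0, hC₂⟩ := ih a₂
    refine ⟨C₀ + C₁ + C₂, by positivity, fun l hl ξ ↦ ?_⟩
    have hw := decayWeight_pos ξ
    have e : (2 * θ + 2 * ((k + 1 : ℕ) : ℝ)) = (2 * θ + 2 * (k : ℝ)) + 2 := by
      push_cast
      ring
    rw [e, ← besselSymbol_mul, ← SchwartzMap.fourierMultiplierCLM_fourierMultiplierCLM_apply
      (besselSymbol_hasTemperateGrowth n _) (besselSymbol_hasTemperateGrowth n _), ha]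
    simp only [map_add, map_smul, _root_.add_apply, _root_.smul_apply]
    refine (norm_add₃_le).trans ?_
    rw [norm_smul, norm_smul, Complex.norm_real, Complex.norm_real, Real.norm_of_nonneg hl,
      Real.norm_of_nonneg (sq_nonneg l)]
    have h1 := hpoly C₀ C₁ C₂ (2 * θ + 2 * (k : ℝ)) l hC₀0 hC₁0 hC₂0 hl
    calc _ ≤ C₀ * (1 + l) ^ (2 * θ + 2 * (k : ℝ)) * decayWeight n ξ +
          l * (C₁ * (1 + l) ^ (2 * θ + 2 * (k : ℝ)) * decayWeight n ξ) +
          l ^ 2 * (C₂ * (1 + l) ^ (2 * θ + 2 * (k : ℝ)) * decayWeight n ξ) := by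
          gcongr
          exacts [hC₀ l hl ξ, hC₁ l hl ξ, hC₂ l hl ξ]
      _ = (C₀ * (1 + l) ^ (2 * θ + 2 * (k : ℝ)) + l * (C₁ * (1 + l) ^ (2 * θ + 2 * (k : ℝ))) +
          l ^ 2 * (C₂ * (1 + l) ^ (2 * θ + 2 * (k : ℝ)))) * decayWeight n ξ := by ring
      _ ≤ _ := by gcongr

end SobolevBound

/-! ### Dispersion of chirps and lower bounds on shells. -/

section Dispersion

variable {n : ℕ}

/-- The dispersive estimate. -/
theorem exists_norm_fourierInv_chirpMul_le (a : 𝓢(EuclideanSpace ℝ (Fin n), ℂ))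
    (ha : HasCompactSupport a) :
    ∃ C, 0 < C ∧ ∀ l : ℝ, 0 < l → ∀ x, ‖(𝓕⁻ (chirpMul l a)) x‖ ≤ C * l ^ (-(n / 2 : ℝ)) := by
  -- A pure chirp has no Gaussian decay, so e^{-|ξ|²} is borrowed from a: the chirp times a is
  -- e^{-z|ξ|²}b with z = 1 - iλ, and compact support keeps b = e^{|ξ|²}a Schwartz.
  have hbs : HasCompactSupport fun ξ ↦ ((Real.exp (‖ξ‖ ^ 2) : ℝ) : ℂ) * a ξ := ha.mul_left
  have hbc : ContDiff ℝ ∞ fun ξ ↦ ((Real.exp (‖ξ‖ ^ 2) : ℝ) : ℂ) * a ξ := by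
    have h1 : ContDiff ℝ ∞ fun ξ : EuclideanSpace ℝ (Fin n) ↦ Real.exp (‖ξ‖ ^ 2) :=
      (contDiff_norm_sq ℝ).exp
    exact (Complex.ofRealCLM.contDiff.comp h1).mul (a.smooth ⊤)
  set b : 𝓢(EuclideanSpace ℝ (Fin n), ℂ) := hbs.toSchwartzMap hbc with hb
  have hb_apply : ∀ ξ, b ξ = ((Real.exp (‖ξ‖ ^ 2) : ℝ) : ℂ) * a ξ := fun ξ ↦ rfl
  set g : 𝓢(EuclideanSpace ℝ (Fin n), ℂ) := 𝓕⁻ b with hg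
  have hI : 0 ≤ ∫ y, ‖g y‖ := integral_nonneg fun _ ↦ norm_nonneg _
  refine ⟨Real.pi ^ (n / 2 : ℝ) * (1 + ∫ y, ‖g y‖), by positivity, fun l hl x ↦ ?_⟩
  set z : ℂ := 1 - l * Complex.I with hz
  have hzre : z.re = 1 := by simp [hz]
  have hzim : z.im = -l := by simp [hz]
  have hz0 : z ≠ 0 := fun h ↦ by simp [h] at hzre
  have hlz : l ≤ ‖z‖ := by
    have := Complex.abs_im_le_norm z
    rwa [hzim, abs_neg, abs_of_pos hl] at this
  have e1 : (𝓕⁻ (chirpMul l a)) x = 𝓕⁻ (fun ξ ↦ Complex.exp (-z * (‖ξ‖ : ℂ) ^ 2) *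
      𝓕 (g : EuclideanSpace ℝ (Fin n) → ℂ) ξ) x := by
    rw [SchwartzMap.fourierInv_coe]
    refine congrFun (congrArg _ (funext fun ξ ↦ ?_)) x
    rw [← SchwartzMap.fourier_coe, hg, FourierTransform.fourier_fourierInv_eq, hb_apply,
      chirpMul_apply, chirp, ← mul_assoc, Complex.ofReal_exp, ← Complex.exp_add]
    congr 2
    rw [hz]
    push_cast
    ring
  rw [e1, fourierInv_gaussian_mul_fourier (by rw [hzre]; norm_num) g.integrable, norm_mul]
  have e2 : ‖((Real.pi : ℂ) / z) ^ (Module.finrank ℝ (EuclideanSpace ℝ (Fin n)) / 2 : ℂ)‖ ≤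
      Real.pi ^ (n / 2 : ℝ) * l ^ (-(n / 2 : ℝ)) := by
    have h1 : (Module.finrank ℝ (EuclideanSpace ℝ (Fin n)) / 2 : ℂ) = ((n / 2 : ℝ) : ℂ) := by
      simp
    rw [h1, Complex.norm_cpow_real, norm_div, Complex.norm_real,
      Real.norm_of_nonneg Real.pi_pos.le, Real.div_rpow Real.pi_pos.le (norm_nonneg _),
      Real.rpow_neg hl.le, div_eq_mul_inv]
    gcongr
  -- Since Re(1/z) ≥ 0 the kernel is bounded by 1; all the decay in λ comes from the prefactor
  -- (π/z)^{n/2}.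
  have e3 : ‖∫ y, g y * Complex.exp (-Real.pi ^ 2 * (‖x - y‖ : ℂ) ^ 2 / z)‖ ≤ ∫ y, ‖g y‖ := by
    refine norm_integral_le_of_norm_le g.integrable.norm (Filter.Eventually.of_forall fun y ↦ ?_)
    rw [norm_mul, Complex.norm_exp]
    refine mul_le_of_le_one_right (norm_nonneg _) (Real.exp_le_one_iff.2 ?_)
    have h1 : -(Real.pi : ℂ) ^ 2 * (‖x - y‖ : ℂ) ^ 2 / z =
        ((-(Real.pi ^ 2 * ‖x - y‖ ^ 2) : ℝ) : ℂ) * z⁻¹ := by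
      push_cast
      ring
    rw [h1, Complex.re_ofReal_mul, Complex.inv_re, hzre]
    have h2 : 0 ≤ Complex.normSq z := Complex.normSq_nonneg z
    have h3 : 0 ≤ Real.pi ^ 2 * ‖x - y‖ ^ 2 * (1 / Complex.normSq z) := by positivity
    linarith
  calc _ ≤ (Real.pi ^ (n / 2 : ℝ) * l ^ (-(n / 2 : ℝ))) * ∫ y, ‖g y‖ := by gcongr
    _ ≤ (Real.pi ^ (n / 2 : ℝ) * l ^ (-(n / 2 : ℝ))) * (1 + ∫ y, ‖g y‖) := by
        gcongr
        linarith
    _ = _ := by ring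

theorem integral_norm_sq_fourierInv_chirpMul (l : ℝ) (a : 𝓢(EuclideanSpace ℝ (Fin n), ℂ)) :
    ∫ x, ‖(𝓕⁻ (chirpMul l a)) x‖ ^ 2 = ∫ ξ, ‖a ξ‖ ^ 2 := by
  rw [← SchwartzMap.integral_norm_sq_fourier, FourierTransform.fourier_fourierInv_eq]
  simp_rw [norm_chirpMul_apply]

theorem SchwartzMap.integrable_norm_rpow (f : 𝓢(EuclideanSpace ℝ (Fin n), ℂ)) {q : ℝ}
    (hq : 0 < q) : Integrable (fun x ↦ ‖f x‖ ^ q) := by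
  have h := (f.memLp (ENNReal.ofReal q)).integrable_norm_rpow (by simpa using hq)
    ENNReal.ofReal_ne_top
  rwa [ENNReal.toReal_ofReal hq.le] at h

theorem SchwartzMap.integral_norm_sq_pos {a : 𝓢(EuclideanSpace ℝ (Fin n), ℂ)} (ha : a ≠ 0) :
    0 < ∫ ξ, ‖a ξ‖ ^ 2 := by
  obtain ⟨ξ, hξ⟩ : ∃ ξ, a ξ ≠ 0 := by
    by_contra! h
    exact ha (by ext ξ; simp [h ξ])
  have hc : Continuous fun ξ ↦ ‖a ξ‖ ^ 2 := by
    have := a.continuous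
    fun_prop
  refine integral_pos_of_integrable_nonneg_nonzero (x := ξ) hc ?_ (fun ξ ↦ by positivity)
    (by simpa using hξ)
  simpa using a.integrable_norm_rpow (q := 2) (by norm_num)

/-- Dispersed chirps with large frequency put a fixed amount of `L^q` mass outside of any given
ball. -/
theorem exists_shell_integral_fourierInv_chirpMul_ge (hn : 1 ≤ n)
    {a : 𝓢(EuclideanSpace ℝ (Fin n), ℂ)} (ha : HasCompactSupport a) (ha0 : a ≠ 0)
    {q s : ℝ} (hq : 0 < q) (hq2 : q < 2) (hs : s * q = n * (2 - q) / 2) :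
    ∃ c, 0 < c ∧ ∀ R₀ : ℝ, ∃ l R₁ : ℝ, 1 ≤ l ∧ R₀ ≤ R₁ ∧
      c ≤ ∫ x in Metric.ball 0 R₁ \ Metric.ball 0 R₀,
        (l ^ (-s) * ‖(𝓕⁻ (chirpMul l a)) x‖) ^ q := by
  obtain ⟨C, hC0, hC⟩ := exists_norm_fourierInv_chirpMul_le a ha
  set c₀ := ∫ ξ, ‖a ξ‖ ^ 2 with hc₀
  have hc₀pos : 0 < c₀ := SchwartzMap.integral_norm_sq_pos ha0
  refine ⟨C ^ (q - 2) * (c₀ / 2), by positivity, fun R₀ ↦ ?_⟩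
  set v := volume.real (Metric.ball (0 : EuclideanSpace ℝ (Fin n)) R₀) with hv
  have hv0 : 0 ≤ v := measureReal_nonneg
  -- So large that C²λ^{-n}v ≤ C²λ^{-1}v ≤ c₀/4: at most a quarter of the L² mass stays in the inner
  -- ball. With three quarters inside R₁, half remains on the shell.
  set l : ℝ := max 1 (4 * C ^ 2 * v / c₀) with hl
  have hl1 : 1 ≤ l := le_max_left _ _
  have hl0 : 0 < l := by linarith
  set k : 𝓢(EuclideanSpace ℝ (Fin n), ℂ) := 𝓕⁻ (chirpMul l a) with hk
  have hk2 : Integrable fun x ↦ ‖k x‖ ^ 2 := by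
    simpa using k.integrable_norm_rpow (q := 2) (by norm_num)
  have htot : ∫ x, ‖k x‖ ^ 2 = c₀ := integral_norm_sq_fourierInv_chirpMul l a
  have hinner : ∫ x in Metric.ball 0 R₀, ‖k x‖ ^ 2 ≤ c₀ / 4 := by
    have h1 : ∫ x in Metric.ball 0 R₀, ‖k x‖ ^ 2 ≤
        ∫ x in Metric.ball (0 : EuclideanSpace ℝ (Fin n)) R₀, C ^ 2 * l⁻¹ := by
      refine setIntegral_mono hk2.integrableOn (integrableOn_const
        measure_ball_lt_top.ne) fun x ↦ ?_
      calc ‖k x‖ ^ 2 ≤ (C * l ^ (-(n / 2 : ℝ))) ^ 2 := by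
            gcongr
            exact hC l hl0 x
        _ = C ^ 2 * l ^ (-(n : ℝ)) := by
            rw [mul_pow, ← Real.rpow_two (l ^ _), ← Real.rpow_mul hl0.le]
            congr 2
            ring
        _ ≤ C ^ 2 * l⁻¹ := by
            rw [← Real.rpow_neg_one]
            gcongr
            exact_mod_cast hn
    refine h1.trans ?_
    rw [setIntegral_const, smul_eq_mul, ← hv]
    have h2 : 4 * C ^ 2 * v / c₀ ≤ l := le_max_right _ _
    rw [div_le_iff₀ hc₀pos] at h2
    rw [← mul_assoc, ← div_eq_mul_inv, div_le_iff₀ hl0]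
    linarith
  obtain ⟨R₁, hR₁, houter⟩ : ∃ R₁, R₀ ≤ R₁ ∧ 3 / 4 * c₀ ≤ ∫ x in Metric.ball 0 R₁, ‖k x‖ ^ 2 := by
    have h1 := (aecover_ball (μ := volume) (x := (0 : EuclideanSpace ℝ (Fin n)))
      Filter.tendsto_id).integral_tendsto_of_countably_generated hk2
    rw [htot] at h1
    have h2 := (h1.eventually (eventually_ge_nhds (by linarith : 3 / 4 * c₀ < c₀))).and
      (Filter.eventually_ge_atTop R₀)
    obtain ⟨R, hR, hR'⟩ := h2.exists
    exact ⟨R, hR', hR⟩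
  refine ⟨l, R₁, hl1, hR₁, ?_⟩
  have hshell : c₀ / 2 ≤ ∫ x in Metric.ball 0 R₁ \ Metric.ball 0 R₀, ‖k x‖ ^ 2 := by
    rw [setIntegral_sdiff measurableSet_ball hk2.integrableOn (Metric.ball_subset_ball hR₁)]
    linarith
  calc C ^ (q - 2) * (c₀ / 2)
      ≤ C ^ (q - 2) * ∫ x in Metric.ball 0 R₁ \ Metric.ball 0 R₀, ‖k x‖ ^ 2 := by gcongr
    _ = ∫ x in Metric.ball 0 R₁ \ Metric.ball 0 R₀, C ^ (q - 2) * ‖k x‖ ^ 2 := by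
        rw [integral_const_mul]
    _ ≤ _ := by
        refine setIntegral_mono (hk2.const_mul _).integrableOn ?_ fun x ↦ ?_
        · have h1 : (fun x ↦ (l ^ (-s) * ‖k x‖) ^ q) = fun x ↦ (l ^ (-s)) ^ q * ‖k x‖ ^ q := by
            ext x
            rw [Real.mul_rpow (by positivity) (norm_nonneg _)]
          rw [h1]
          exact ((k.integrable_norm_rpow hq).const_mul _).integrableOn
        · change C ^ (q - 2) * ‖k x‖ ^ 2 ≤ (l ^ (-s) * ‖k x‖) ^ q
          rcases (norm_nonneg (k x)).eq_or_lt with h0 | h0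
          · rw [← h0]
            simp [Real.zero_rpow hq.ne']
          -- The L² mass is turned into L^q mass by bounding |k|^{2-q} with the dispersive estimate;
          -- by `hs` the power of λ gained is exactly λ^{-sq}.
          · have hb : ‖k x‖ ≤ C * l ^ (-(n / 2 : ℝ)) := hC l hl0 x
            have h1 : ‖k x‖ ^ 2 = ‖k x‖ ^ q * ‖k x‖ ^ (2 - q) := by
              rw [← Real.rpow_add h0, ← Real.rpow_two]
              ring_nf
            have h2 : ‖k x‖ ^ (2 - q) ≤ (C * l ^ (-(n / 2 : ℝ))) ^ (2 - q) :=
              Real.rpow_le_rpow h0.le hb (by linarith)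
            have h3 : (C * l ^ (-(n / 2 : ℝ))) ^ (2 - q) = C ^ (2 - q) * l ^ (-s * q) := by
              rw [Real.mul_rpow hC0.le (by positivity), ← Real.rpow_mul hl0.le]
              congr 2
              linarith
            have h4 : C ^ (q - 2) * C ^ (2 - q) = 1 := by
              rw [← Real.rpow_add hC0]
              simp
            calc C ^ (q - 2) * ‖k x‖ ^ 2
                ≤ C ^ (q - 2) * (‖k x‖ ^ q * (C ^ (2 - q) * l ^ (-s * q))) := by
                  rw [h1, ← h3]
                  gcongr
              _ = (C ^ (q - 2) * C ^ (2 - q)) * (l ^ (-s * q) * ‖k x‖ ^ q) := by ring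
              _ = _ := by
                  rw [h4, one_mul, Real.mul_rpow (by positivity) h0.le, ← Real.rpow_mul hl0.le]

/-- A nonzero even bump function on an annulus. -/
theorem exists_even_annulus_bump (hn : 1 ≤ n) :
    ∃ χ : 𝓢(EuclideanSpace ℝ (Fin n), ℂ), HasCompactSupport χ ∧ χ ≠ 0 ∧
      (∀ ξ, χ (-ξ) = χ ξ) ∧ ∀ ξ, χ ξ ≠ 0 → 1 / 2 ≤ ‖ξ‖ ^ 2 ∧ ‖ξ‖ ^ 2 ≤ 2 := by
  -- Composed with |ξ|², a bump around 1 gives a smooth radial, hence even, function.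
  let β : ContDiffBump (1 : ℝ) := ⟨1 / 4, 1 / 2, by norm_num, by norm_num⟩
  have hsupp : ∀ ξ : EuclideanSpace ℝ (Fin n), ((β (‖ξ‖ ^ 2) : ℝ) : ℂ) ≠ 0 →
      1 / 2 ≤ ‖ξ‖ ^ 2 ∧ ‖ξ‖ ^ 2 ≤ 2 := by
    intro ξ hξ
    have h1 : ‖ξ‖ ^ 2 ∈ Function.support β := by simpa using hξ
    rw [β.support_eq, Metric.mem_ball, Real.dist_eq, abs_lt] at h1
    have h2 : β.rOut = 1 / 2 := rfl
    rw [h2] at h1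
    constructor <;> linarith [h1.1, h1.2]
  have hc : HasCompactSupport fun ξ : EuclideanSpace ℝ (Fin n) ↦ ((β (‖ξ‖ ^ 2) : ℝ) : ℂ) := by
    refine HasCompactSupport.of_support_subset_isCompact (isCompact_closedBall 0 2) fun ξ hξ ↦ ?_
    rw [mem_closedBall_zero_iff]
    nlinarith [(hsupp ξ hξ).2, norm_nonneg ξ]
  have hd : ContDiff ℝ ∞ fun ξ : EuclideanSpace ℝ (Fin n) ↦ ((β (‖ξ‖ ^ 2) : ℝ) : ℂ) :=
    Complex.ofRealCLM.contDiff.comp (β.contDiff.comp (contDiff_norm_sq ℝ))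
  refine ⟨hc.toSchwartzMap hd, hc, fun h ↦ ?_, fun ξ ↦ ?_, hsupp⟩
  · have h1 : hc.toSchwartzMap hd (EuclideanSpace.single ⟨0, hn⟩ 1) = 0 := by rw [h]; rfl
    change ((β (‖EuclideanSpace.single (⟨0, hn⟩ : Fin n) (1 : ℝ)‖ ^ 2) : ℝ) : ℂ) = 0 at h1
    rw [PiLp.norm_single, norm_one, one_pow, β.one_of_mem_closedBall] at h1
    · simp at h1
    · exact Metric.mem_closedBall_self β.rIn_pos.le
  · change ((β (‖-ξ‖ ^ 2) : ℝ) : ℂ) = ((β (‖ξ‖ ^ 2) : ℝ) : ℂ)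
    rw [norm_neg]

end Dispersion

/-! ### Sobolev norms of random chirp sums. -/

section SobolevNorm

variable {n : ℕ}

theorem isGivenBy_coe (G : 𝓢(EuclideanSpace ℝ (Fin n), ℂ)) :
    IsGivenBy (SchwartzMap.toTemperedDistributionCLM (EuclideanSpace ℝ (Fin n)) ℂ volume G) G := by
  intro ψ
  constructor
  · have h := (SchwartzMap.smulLeftCLM ℂ ψ G).integrable (μ := volume)
    refine h.congr (Filter.Eventually.of_forall fun x ↦ ?_)
    simp only
    rw [SchwartzMap.smulLeftCLM_apply_apply ψ.hasTemperateGrowth, smul_eq_mul]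
  · rw [SchwartzMap.toTemperedDistributionCLM_apply_apply volume]
    rfl

theorem sobolevNorm_coe_le (s r : ℝ) (G : 𝓢(EuclideanSpace ℝ (Fin n), ℂ)) :
    sobolevNorm s r G ≤
      eLpNorm (SchwartzMap.fourierMultiplierCLM ℂ (besselSymbol n s) G) (ENNReal.ofReal r) := by
  unfold sobolevNorm
  refine iInf₂_le_of_le _ (isGivenBy_coe G) (iInf₂_le_of_le _
    (SchwartzMap.memLp (SchwartzMap.fourierMultiplierCLM ℂ (besselSymbol n s) G) _ volume) ?_)
  refine iInf_le_of_le ?_ le_rfl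
  have h := isGivenBy_coe (SchwartzMap.fourierMultiplierCLM ℂ (besselSymbol n s) G)
  rwa [← TemperedDistribution.fourierMultiplierCLM_toTemperedDistributionCLM_eq
    (besselSymbol_hasTemperateGrowth n s)] at h

/-- The finite measure with density `decayWeight`. -/
noncomputable def decayMeasure (n : ℕ) : Measure (EuclideanSpace ℝ (Fin n)) :=
  volume.withDensity fun x ↦ ENNReal.ofReal (decayWeight n x)

instance (n : ℕ) : IsFiniteMeasure (decayMeasure n) :=
  isFiniteMeasure_withDensity_ofReal (integrable_decayWeight n).2

/-- With w the weight, w·w^{-r} ≥ 1 because w ≤ 1 ≤ r. Passing to a finite measure allows r to be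
raised to an integer R, for which Khintchine is available. -/
theorem eLpNorm_le_eLpNorm_decayMeasure {r : ℝ} (hr : 1 ≤ r)
    (h : EuclideanSpace ℝ (Fin n) → ℂ) :
    eLpNorm h (ENNReal.ofReal r) ≤
      eLpNorm (fun x ↦ (decayWeight n x)⁻¹ • h x) (ENNReal.ofReal r) (decayMeasure n) := by
  have hr0 : 0 < r := by linarith
  rw [eLpNorm_eq_lintegral_rpow_enorm_toReal (by simpa using hr0) ENNReal.ofReal_ne_top,
    eLpNorm_eq_lintegral_rpow_enorm_toReal (by simpa using hr0) ENNReal.ofReal_ne_top,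
    ENNReal.toReal_ofReal hr0.le, decayMeasure,
    lintegral_withDensity_eq_lintegral_mul_non_measurable _
      (continuous_decayWeight n).measurable.ennreal_ofReal
      (Filter.Eventually.of_forall fun x ↦ ENNReal.ofReal_lt_top)]
  gcongr with x
  have hw := decayWeight_pos x
  have h1 : ENNReal.ofReal (decayWeight n x) ≤ 1 := by
    simpa using ENNReal.ofReal_le_ofReal (decayWeight_le_one x)
  have h2 : ENNReal.ofReal (decayWeight n x) ≠ 0 := by simpa using hw
  simp only [Pi.mul_apply]
  rw [enorm_smul, Real.enorm_eq_ofReal (by positivity), ENNReal.ofReal_inv_of_pos hw,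
    ENNReal.mul_rpow_of_nonneg _ _ hr0.le, ← mul_assoc, ENNReal.inv_rpow]
  refine le_mul_of_one_le_left zero_le ?_
  rw [← div_eq_mul_inv, ENNReal.le_div_iff_mul_le (Or.inl (by simp [h2]))
    (Or.inl (ENNReal.rpow_ne_top_of_nonneg hr0.le ENNReal.ofReal_ne_top)), one_mul]
  exact ENNReal.rpow_le_self_of_le_one h1 hr

theorem exists_eLpNorm_le_lintegral_decayMeasure (n : ℕ) {r : ℝ} (hr : 1 ≤ r) {R : ℕ}
    (hR : r ≤ R) :
    ∃ C : ℝ≥0, ∀ h : EuclideanSpace ℝ (Fin n) → ℂ, Continuous h →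
      eLpNorm h (ENNReal.ofReal r) ≤
        C * (∫⁻ x, ‖(decayWeight n x)⁻¹ • h x‖ₑ ^ R ∂(decayMeasure n)) ^ (1 / (R : ℝ)) := by
  have hR0 : (0 : ℝ) < R := by linarith
  set A := (decayMeasure n) Set.univ ^ (1 / (ENNReal.ofReal r).toReal -
    1 / (ENNReal.ofReal (R : ℝ)).toReal) with hA
  have hAtop : A ≠ ⊤ := by
    refine ENNReal.rpow_ne_top_of_nonneg ?_ (measure_ne_top _ _)
    rw [ENNReal.toReal_ofReal (by linarith), ENNReal.toReal_ofReal hR0.le, sub_nonneg]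
    gcongr
  refine ⟨A.toNNReal, fun h hh ↦ ?_⟩
  rw [ENNReal.coe_toNNReal hAtop]
  refine (eLpNorm_le_eLpNorm_decayMeasure hr h).trans ?_
  refine (eLpNorm_le_eLpNorm_mul_rpow_measure_univ (ENNReal.ofReal_le_ofReal hR) ?_).trans ?_
  · refine Continuous.aestronglyMeasurable ?_
    exact ((continuous_decayWeight n).inv₀ fun x ↦ (decayWeight_pos x).ne').smul hh
  · rw [← hA, mul_comm, eLpNorm_eq_lintegral_rpow_enorm_toReal (by simpa using Nat.cast_pos.1 hR0 |>.ne')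
      ENNReal.ofReal_ne_top, ENNReal.toReal_ofReal hR0.le]
    simp only [ENNReal.rpow_natCast, le_refl]

/-- A random signed sum of normalized chirps. -/
noncomputable def signedChirpSum {ι : Type*} [Fintype ι] (s t : ℝ) (N : ι → ℝ) (ε : ι → ℤˣ)
    (a : 𝓢(EuclideanSpace ℝ (Fin n), ℂ)) : 𝓢(EuclideanSpace ℝ (Fin n), ℂ) :=
  ∑ j, ((ε j : ℤ) : ℝ) • ((N j ^ (-s) : ℝ) • chirpMul (t * N j) a)

theorem signedChirpSum_apply {ι : Type*} [Fintype ι] (s t : ℝ) (N : ι → ℝ) (ε : ι → ℤˣ)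
    (a : 𝓢(EuclideanSpace ℝ (Fin n), ℂ)) (ξ : EuclideanSpace ℝ (Fin n)) :
    signedChirpSum s t N ε a ξ =
      (∑ j, (((ε j : ℤ) : ℝ) : ℂ) * ((N j ^ (-s) : ℝ) : ℂ) * chirp (t * N j) ξ) * a ξ := by
  rw [signedChirpSum, _root_.sum_apply, Finset.sum_mul]
  simp only [_root_.smul_apply, chirpMul_apply, Complex.real_smul]
  congr 1
  ext j
  ring

/-- Y is the R-th moment of the weighted function for one sign pattern. It is kept separately for
each ε, so that a power of it can still be averaged later. The constant does not depend on K or on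
the frequencies. -/
theorem exists_sum_signs_sobolevNorm_le {s t r : ℝ} (hs : 0 ≤ s) (ht : 0 ≤ t) (hr : 1 ≤ r) {R : ℕ}
    (hR : r ≤ R) (a : 𝓢(EuclideanSpace ℝ (Fin n), ℂ)) :
    ∃ C : ℝ≥0, ∀ (K : ℕ) (N : Fin K → ℝ), (∀ j, 1 ≤ N j) → ∃ Y : (Fin K → ℤˣ) → ℝ≥0∞,
      (∀ ε, sobolevNorm s r (signedChirpSum s t N ε a) ≤ C * Y ε ^ (1 / (R : ℝ))) ∧
      ∑ ε, Y ε ≤ Fintype.card (Fin K → ℤˣ) * (C * ENNReal.ofReal (Real.sqrt K ^ R)) := by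
  obtain ⟨C₁, hC₁⟩ := exists_eLpNorm_le_lintegral_decayMeasure n hr hR
  obtain ⟨C₂, hC₂0, hC₂⟩ := exists_norm_besselSymbol_chirpMul_le hs a
  set A : ℝ := 2 ^ R * (2 * (R.factorial * (2 * Real.exp (1 / 2)))) with hA
  have hA0 : 0 ≤ A := by positivity
  set b : ℝ := C₂ * (1 + t) ^ s with hb
  have hb0 : 0 ≤ b := by positivity
  set C₃ : ℝ≥0∞ := ENNReal.ofReal (A * b ^ R) * decayMeasure n Set.univ with hC₃
  have hC₃top : C₃ ≠ ⊤ := ENNReal.mul_ne_top ENNReal.ofReal_ne_top (measure_ne_top _ _)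
  refine ⟨C₁ + C₃.toNNReal, fun K N hN ↦ ?_⟩
  set T := SchwartzMap.fourierMultiplierCLM ℂ (besselSymbol n s) with hT
  have hTsum : ∀ ε x, T (signedChirpSum s t N ε a) x =
      ∑ j, ((ε j : ℤ) : ℝ) • ((N j ^ (-s) : ℝ) • T (chirpMul (t * N j) a) x) := by
    intro ε x
    rw [signedChirpSum, map_sum, _root_.sum_apply]
    congr 1
    ext j
    rw [ContinuousLinearMap.map_smul_of_tower, ContinuousLinearMap.map_smul_of_tower]
    rfl
  -- The normalization N^{-s} cancels the cost (1 + tN)^s ≤ ((1+t)N)^s, valid as N ≥ 1; the weight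
  -- makes the bound uniform in x.
  have hbound : ∀ x j, ‖(decayWeight n x)⁻¹ • ((N j ^ (-s) : ℝ) • T (chirpMul (t * N j) a) x)‖ ≤
      b := by
    intro x j
    have hw := decayWeight_pos x
    have hNj : 0 < N j := by linarith [hN j]
    have h1 := hC₂ (t * N j) (by positivity) x
    rw [norm_smul, norm_smul, Real.norm_of_nonneg (by positivity),
      Real.norm_of_nonneg (by positivity), inv_mul_le_iff₀ hw]
    calc N j ^ (-s) * ‖T (chirpMul (t * N j) a) x‖
        ≤ N j ^ (-s) * (C₂ * (1 + t * N j) ^ s * decayWeight n x) := by gcongr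
      _ ≤ N j ^ (-s) * (C₂ * ((1 + t) * N j) ^ s * decayWeight n x) := by
          gcongr
          nlinarith [hN j]
      _ = (N j ^ (-s) * N j ^ s) * (decayWeight n x * b) := by
          rw [Real.mul_rpow (by positivity) hNj.le, hb]
          ring
      _ = _ := by rw [← Real.rpow_add hNj]; simp
  refine ⟨fun ε ↦ ∫⁻ x, ‖(decayWeight n x)⁻¹ • T (signedChirpSum s t N ε a) x‖ₑ ^ R
    ∂(decayMeasure n), fun ε ↦ ?_, ?_⟩
  · refine (sobolevNorm_coe_le s r _).trans ((hC₁ _ (SchwartzMap.continuous _)).trans ?_)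
    gcongr
    exact le_self_add
  · have hmeas : ∀ ε : Fin K → ℤˣ, Measurable fun x : EuclideanSpace ℝ (Fin n) ↦
        ‖(decayWeight n x)⁻¹ • T (signedChirpSum s t N ε a) x‖ₑ ^ R := by
      intro ε
      have h1 : Continuous fun x : EuclideanSpace ℝ (Fin n) ↦
          (decayWeight n x)⁻¹ • T (signedChirpSum s t N ε a) x :=
        ((continuous_decayWeight n).inv₀ fun x ↦ (decayWeight_pos x).ne').smul
          (SchwartzMap.continuous _)
      exact h1.enorm.measurable.pow_const R
    rw [← lintegral_finsetSum _ fun ε _ ↦ hmeas ε]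
    -- Khintchine at each fixed x, to be integrated against the finite measure.
    have hpt : ∀ x : EuclideanSpace ℝ (Fin n),
        ∑ ε, ‖(decayWeight n x)⁻¹ • T (signedChirpSum s t N ε a) x‖ₑ ^ R ≤
          ENNReal.ofReal (Fintype.card (Fin K → ℤˣ) * A * (Real.sqrt K * b) ^ R) := by
      intro x
      have h1 := sum_signs_norm_pow_le
        (fun j ↦ (decayWeight n x)⁻¹ • ((N j ^ (-s) : ℝ) • T (chirpMul (t * N j) a) x))
        (hbound x) R
      rw [Fintype.card_fin] at h1
      have h2 : ∑ ε, ‖(decayWeight n x)⁻¹ • T (signedChirpSum s t N ε a) x‖ₑ ^ R =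
          ENNReal.ofReal (∑ ε, ‖(decayWeight n x)⁻¹ • T (signedChirpSum s t N ε a) x‖ ^ R) := by
        rw [ENNReal.ofReal_sum_of_nonneg fun ε _ ↦ by positivity]
        simp_rw [ENNReal.ofReal_pow (norm_nonneg _), ofReal_norm]
      rw [h2]
      refine ENNReal.ofReal_le_ofReal (le_trans (le_of_eq ?_) h1)
      congr 1
      ext ε
      rw [hTsum, Finset.smul_sum]
      simp_rw [smul_comm (decayWeight n x)⁻¹]
    refine (lintegral_mono hpt).trans ?_
    rw [lintegral_const]
    have h3 : (Fintype.card (Fin K → ℤˣ) * A * (Real.sqrt K * b) ^ R : ℝ) =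
        (Fintype.card (Fin K → ℤˣ) : ℝ) * ((A * b ^ R) * Real.sqrt K ^ R) := by ring
    rw [h3, ENNReal.ofReal_mul (by positivity), ENNReal.ofReal_natCast,
      ENNReal.ofReal_mul (by positivity), mul_assoc, mul_right_comm, ← hC₃]
    gcongr
    rw [ENNReal.coe_add, ENNReal.coe_toNNReal hC₃top]
    exact le_add_self

end SobolevNorm

/-! ### Duality between L^p and L^q. -/

section Duality

variable {n : ℕ}

theorem SchwartzMap.toReal_eLpNorm_eq_integral_rpow (F : 𝓢(EuclideanSpace ℝ (Fin n), ℂ)) {q : ℝ}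
    (hq : 0 < q) :
    (eLpNorm F (ENNReal.ofReal q)).toReal = (∫ x, ‖F x‖ ^ q) ^ (1 / q) := by
  have h1 : (ENNReal.ofReal q) ≠ 0 := by simpa using hq
  rw [(F.memLp _ _).eLpNorm_eq_integral_rpow_norm h1 ENNReal.ofReal_ne_top,
    ENNReal.toReal_ofReal hq.le, ENNReal.toReal_ofReal (by positivity), one_div]

/-- The `L^q` norm of a Schwartz function is the norm of the functional it induces on Schwartz
functions with the `L^p` norm. -/
theorem SchwartzMap.toReal_eLpNorm_le_of_forall_norm_integral_le (F : 𝓢(EuclideanSpace ℝ (Fin n), ℂ))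
    {p q A : ℝ} (hpq : p.HolderConjugate q) (hA : 0 ≤ A)
    (h : ∀ ψ : 𝓢(EuclideanSpace ℝ (Fin n), ℂ),
      ‖∫ x, F x * ψ x‖ ≤ A * (eLpNorm ψ (ENNReal.ofReal p)).toReal) :
    (eLpNorm F (ENNReal.ofReal q)).toReal ≤ A := by
  have hp := hpq.lt
  have hq := hpq.symm.lt
  have hp0 : (ENNReal.ofReal p) ≠ 0 := by simpa using hpq.pos
  have : Fact (1 ≤ ENNReal.ofReal p) := ⟨by simpa using hp.le⟩
  have : Fact (1 ≤ ENNReal.ofReal q) := ⟨by simpa using hq.le⟩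
  have : (ENNReal.ofReal q).HolderConjugate (ENNReal.ofReal p) := hpq.symm.ennrealOfReal
  set Φ := (ContinuousLinearMap.mul ℂ ℂ).lpPairing volume (ENNReal.ofReal q) (ENNReal.ofReal p)
    (F.toLp (ENNReal.ofReal q)) with hΦ
  have hΦ_apply : ∀ g : Lp ℂ (ENNReal.ofReal p) (volume : Measure (EuclideanSpace ℝ (Fin n))),
      Φ g = ∫ x, F x * g x := by
    intro g
    rw [hΦ, ContinuousLinearMap.lpPairing_eq_integral]
    refine integral_congr_ae ?_
    filter_upwards [F.coeFn_toLp (ENNReal.ofReal q) volume] with x hx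
    rw [hx]
    rfl
  have hall : ∀ g, ‖Φ g‖ ≤ A * ‖g‖ := by
    intro g
    refine (SchwartzMap.denseRange_toLpCLM (F := ℂ) (p := ENNReal.ofReal p) (μ := volume)
      ENNReal.ofReal_ne_top).induction_on (p := fun g ↦ ‖Φ g‖ ≤ A * ‖g‖) g ?_ ?_
    · exact isClosed_le (by fun_prop) (by fun_prop)
    · intro ψ
      rw [hΦ_apply, SchwartzMap.toLpCLM_apply, SchwartzMap.norm_toLp]
      refine le_trans (le_of_eq ?_) (h ψ)
      congr 1
      refine integral_congr_ae ?_
      filter_upwards [ψ.coeFn_toLp (ENNReal.ofReal p) volume] with x hx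
      rw [hx]
  -- The extremizer in Hölder's inequality. It need not be Schwartz, which is why the functional was
  -- first bounded on all of L^p by density.
  set ψ : EuclideanSpace ℝ (Fin n) → ℂ := fun x ↦
    ((‖F x‖ ^ (q - 2) : ℝ) : ℂ) * (starRingEnd ℂ) (F x) with hψ
  have hψm : AEStronglyMeasurable ψ volume := by
    have hF : Measurable F := F.continuous.measurable
    refine Measurable.aestronglyMeasurable ?_
    exact (Complex.measurable_ofReal.comp (hF.norm.pow_const _)).mul
      (Complex.continuous_conj.measurable.comp hF)
  have hFψ : ∀ x, F x * ψ x = ((‖F x‖ ^ q : ℝ) : ℂ) := by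
    intro x
    have h1 : F x * ψ x = ((‖F x‖ ^ (q - 2) : ℝ) : ℂ) * (F x * (starRingEnd ℂ) (F x)) := by
      simp only [hψ]; ring
    rw [h1, Complex.mul_conj, Complex.normSq_eq_norm_sq, ← Complex.ofReal_mul]
    congr 1
    rcases (norm_nonneg (F x)).eq_or_lt with h0 | h0
    · rw [← h0, Real.zero_rpow (by linarith : q ≠ 0)]
      simp
    · rw [← Real.rpow_two, ← Real.rpow_add h0]
      ring_nf
  have hψn : ∀ x, ‖ψ x‖ ^ p = ‖F x‖ ^ q := by
    intro x
    simp only [hψ]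
    rw [norm_mul, Complex.norm_real, Real.norm_of_nonneg (by positivity), RCLike.norm_conj]
    rcases (norm_nonneg (F x)).eq_or_lt with h0 | h0
    · rw [← h0, mul_zero, Real.zero_rpow (by linarith : q ≠ 0), Real.zero_rpow hpq.ne_zero]
    · nth_rw 2 [← Real.rpow_one ‖F x‖]
      rw [← Real.rpow_add h0, ← Real.rpow_mul h0.le]
      congr 1
      have := hpq.symm.sub_one_mul_conj
      linarith
  have hψL : MemLp ψ (ENNReal.ofReal p) volume := by
    rw [← integrable_norm_rpow_iff hψm hp0 ENNReal.ofReal_ne_top,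
      ENNReal.toReal_ofReal hpq.nonneg]
    simp_rw [hψn]
    exact F.integrable_norm_rpow hpq.symm.pos
  set X := ∫ x, ‖F x‖ ^ q with hX
  have hX0 : 0 ≤ X := integral_nonneg fun x ↦ by positivity
  have key := hall (hψL.toLp ψ)
  have e1 : Φ (hψL.toLp ψ) = (X : ℂ) := by
    rw [hΦ_apply, hX, ← integral_complex_ofReal]
    refine integral_congr_ae ?_
    filter_upwards [hψL.coeFn_toLp] with x hx
    rw [hx, hFψ]
  have e2 : ‖hψL.toLp ψ‖ = X ^ (1 / p) := by
    rw [Lp.norm_toLp, hψL.eLpNorm_eq_integral_rpow_norm hp0 ENNReal.ofReal_ne_top,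
      ENNReal.toReal_ofReal hpq.nonneg]
    simp_rw [hψn]
    rw [ENNReal.toReal_ofReal (by positivity), one_div]
  rw [e1, e2, Complex.norm_real, Real.norm_of_nonneg hX0] at key
  rw [F.toReal_eLpNorm_eq_integral_rpow hpq.symm.pos, ← hX]
  rcases hX0.eq_or_lt with h0 | h0
  · rw [← h0, Real.zero_rpow (by have := hpq.symm.pos; positivity)]
    exact hA
  · have h1 : X = X ^ (1 / q) * X ^ (1 / p) := by
      rw [← Real.rpow_add h0, one_div, one_div, hpq.symm.inv_add_inv_eq_one, Real.rpow_one]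
    have h2 : 0 < X ^ (1 / p) := by positivity
    exact le_of_mul_le_mul_right (h1.symm.le.trans key) h2

/-- For the bilinear pairing the transpose of a multiplier has the reflected symbol, so an even
symbol is its own transpose; evenness of χ absorbs the other reflection. -/
theorem integral_fourierInv_smulLeftCLM_mul {M χ : 𝓢(EuclideanSpace ℝ (Fin n), ℂ)}
    (hM : ∀ ξ, M (-ξ) = M ξ) (hχ : ∀ ξ, χ (-ξ) = χ ξ) (ψ : 𝓢(EuclideanSpace ℝ (Fin n), ℂ)) :
    ∫ x, (𝓕⁻ (SchwartzMap.smulLeftCLM ℂ M χ)) x * ψ x =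
      ∫ x, (𝓕⁻ χ) x * SchwartzMap.fourierMultiplierCLM ℂ M ψ x := by
  have hMg := M.hasTemperateGrowth
  have hneg : ∀ (g : 𝓢(EuclideanSpace ℝ (Fin n), ℂ)) ξ, (𝓕⁻ g) (-ξ) = (𝓕 g) ξ := by
    intro g ξ
    rw [SchwartzMap.fourierInv_coe, SchwartzMap.fourier_coe, Real.fourierInv_eq_fourier_neg,
      neg_neg]
  have hχ' : 𝓕⁻ (𝓕⁻ χ) = χ := by
    ext ξ
    have h1 : (𝓕⁻ (𝓕⁻ χ)) (-(-ξ)) = (𝓕 (𝓕⁻ χ)) (-ξ) := hneg _ _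
    rw [neg_neg, FourierTransform.fourier_fourierInv_eq, hχ] at h1
    exact h1
  rw [SchwartzMap.integral_fourierInv_mul_eq (SchwartzMap.smulLeftCLM ℂ M χ) ψ,
    SchwartzMap.fourierMultiplierCLM_apply,
    ← SchwartzMap.integral_fourierInv_mul_eq (𝓕⁻ χ) (SchwartzMap.smulLeftCLM ℂ M (𝓕 ψ)), hχ',
    ← integral_neg_eq_self]
  congr 1
  ext ξ
  rw [hneg, SchwartzMap.smulLeftCLM_apply_apply hMg, SchwartzMap.smulLeftCLM_apply_apply hMg,
    hM, hχ, smul_eq_mul, smul_eq_mul]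
  ring

theorem SchwartzMap.eLpNorm_le_of_integral_mul_eq {F f : 𝓢(EuclideanSpace ℝ (Fin n), ℂ)}
    {T : 𝓢(EuclideanSpace ℝ (Fin n), ℂ) → 𝓢(EuclideanSpace ℝ (Fin n), ℂ)}
    (hT : ∀ ψ, ∫ x, F x * ψ x = ∫ x, f x * T ψ x) {p q : ℝ} (hpq : p.HolderConjugate q)
    {B : ℝ≥0∞} (hB : B ≠ ⊤)
    (h : ∀ ψ, eLpNorm (T ψ) (ENNReal.ofReal p) ≤ B * eLpNorm ψ (ENNReal.ofReal p)) :
    eLpNorm F (ENNReal.ofReal q) ≤ B * eLpNorm f (ENNReal.ofReal q) := by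
  have htop : ∀ (g : 𝓢(EuclideanSpace ℝ (Fin n), ℂ)) (r : ℝ),
      eLpNorm g (ENNReal.ofReal r) ≠ ⊤ := fun g r ↦ (g.eLpNorm_lt_top _ volume).ne
  have key := SchwartzMap.toReal_eLpNorm_le_of_forall_norm_integral_le F hpq
    (A := (B * eLpNorm f (ENNReal.ofReal q)).toReal) ENNReal.toReal_nonneg (fun ψ ↦ by
      rw [hT]
      have h1 := ENNReal.toReal_mono (ENNReal.mul_ne_top hB (htop ψ p)) (h ψ)
      have h2 : ‖∫ x, f x * T ψ x‖ ≤ (eLpNorm f (ENNReal.ofReal q)).toReal *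
          (eLpNorm (T ψ) (ENNReal.ofReal p)).toReal := by
        refine (norm_integral_le_integral_norm _).trans ?_
        simp_rw [norm_mul]
        rw [SchwartzMap.toReal_eLpNorm_eq_integral_rpow _ hpq.pos,
          SchwartzMap.toReal_eLpNorm_eq_integral_rpow _ hpq.symm.pos]
        exact integral_mul_norm_le_Lp_mul_Lq hpq.symm (f.memLp _ volume) ((T ψ).memLp _ volume)
      refine h2.trans ((mul_le_mul_of_nonneg_left h1 ENNReal.toReal_nonneg).trans (le_of_eq ?_))
      simp only [ENNReal.toReal_mul]
      ring)
  exact (ENNReal.toReal_le_toReal (htop F q) (ENNReal.mul_ne_top hB (htop f q))).1 key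

end Duality

/-! ### Assembling the counterexample. -/

section Counterexample

variable {n : ℕ}

/-- Jensen's inequality for the uniform average. It lowers the R-th moment bound to the exponent q.
-/
theorem ENNReal.sum_rpow_le_card_mul_rpow {ι : Type*} [Fintype ι] [Nonempty ι] {Y : ι → ℝ≥0∞}
    {X : ℝ≥0∞} (h : ∑ i, Y i ≤ Fintype.card ι * X) {θ : ℝ} (h0 : 0 < θ) (h1 : θ ≤ 1) :
    ∑ i, Y i ^ θ ≤ Fintype.card ι * X ^ θ := by
  set Q : ℝ≥0∞ := (Fintype.card ι : ℝ≥0∞) with hQ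
  have hQ0 : Q ≠ 0 := by simp [hQ]
  have hQt : Q ≠ ⊤ := by simp [hQ]
  have key := ENNReal.rpow_arith_mean_le_arith_mean_rpow Finset.univ (fun _ : ι ↦ Q⁻¹)
    (fun i ↦ Y i ^ θ) (by simp [← hQ, ENNReal.mul_inv_cancel hQ0 hQt])
    ((one_le_inv₀ h0).2 h1)
  simp_rw [← ENNReal.rpow_mul, mul_inv_cancel₀ h0.ne', ENNReal.rpow_one, ← Finset.mul_sum] at key
  have h2 : (Q⁻¹ * ∑ i, Y i ^ θ) ^ θ⁻¹ ≤ X := by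
    refine key.trans ?_
    calc _ ≤ Q⁻¹ * (Q * X) := by gcongr
      _ = X := by rw [← mul_assoc, ENNReal.inv_mul_cancel hQ0 hQt, one_mul]
  have h3 := ENNReal.rpow_le_rpow h2 h0.le
  rw [← ENNReal.rpow_mul, inv_mul_cancel₀ h0.ne', ENNReal.rpow_one] at h3
  calc ∑ i, Y i ^ θ = Q * (Q⁻¹ * ∑ i, Y i ^ θ) := by
        rw [← mul_assoc, ENNReal.mul_inv_cancel hQ0 hQt, one_mul]
    _ ≤ _ := by gcongr

theorem exists_nat_mul_gt_mul_sqrt_rpow {c C q : ℝ} (hc : 0 < c) (hq : q < 2) :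
    ∃ K : ℕ, C * Real.sqrt K ^ q < K * c := by
  have h1 : Filter.Tendsto (fun K : ℕ ↦ (K : ℝ) ^ (1 - q / 2)) Filter.atTop Filter.atTop :=
    (tendsto_rpow_atTop (by linarith)).comp tendsto_natCast_atTop_atTop
  obtain ⟨K, hK, hK1⟩ := ((h1.eventually (Filter.eventually_gt_atTop (C / c))).and
    (Filter.eventually_ge_atTop 1)).exists
  refine ⟨K, ?_⟩
  have hK0 : (0 : ℝ) < K := by exact_mod_cast hK1
  rw [div_lt_iff₀ hc] at hK
  have h2 : Real.sqrt K ^ q = (K : ℝ) ^ (q / 2) := by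
    rw [Real.sqrt_eq_rpow, ← Real.rpow_mul hK0.le]
    ring_nf
  have h3 : (K : ℝ) = (K : ℝ) ^ (1 - q / 2) * (K : ℝ) ^ (q / 2) := by
    rw [← Real.rpow_add hK0]
    simp
  have h4 : (0 : ℝ) < (K : ℝ) ^ (q / 2) := by positivity
  calc C * Real.sqrt K ^ q < ((K : ℝ) ^ (1 - q / 2) * c) * (K : ℝ) ^ (q / 2) := by
        rw [h2]
        gcongr
    _ = ((K : ℝ) ^ (1 - q / 2) * (K : ℝ) ^ (q / 2)) * c := by ring
    _ = _ := by rw [← h3]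

theorem hasCompactSupport_of_support_subset_annulus {φ : EuclideanSpace ℝ (Fin n) → ℂ}
    (hφsupp : Function.support φ ⊆ {ξ | 1 / 2 < ‖ξ‖ ∧ ‖ξ‖ < 2}) : HasCompactSupport φ := by
  refine HasCompactSupport.of_support_subset_isCompact (isCompact_closedBall 0 2) fun ξ hξ ↦ ?_
  rw [mem_closedBall_zero_iff]
  exact (hφsupp hξ).2.le

/-- The dyadic pieces of a sum of chirps are sums of chirps. -/
theorem exists_mul_signedChirpSum_dilate_eq {φ : EuclideanSpace ℝ (Fin n) → ℂ}
    (hφ : ContDiff ℝ ∞ φ) (hφsupp : Function.support φ ⊆ {ξ | 1 / 2 < ‖ξ‖ ∧ ‖ξ‖ < 2})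
    {χ : 𝓢(EuclideanSpace ℝ (Fin n), ℂ)}
    (hχ : ∀ ξ, χ ξ ≠ 0 → 1 / 2 ≤ ‖ξ‖ ^ 2 ∧ ‖ξ‖ ^ 2 ≤ 2) (D : ℤ) :
    ∃ a : 𝓢(EuclideanSpace ℝ (Fin n), ℂ), (D ∉ Finset.Icc (-1 : ℤ) 1 → a = 0) ∧
      ∀ (s : ℝ) (K : ℕ) (N : Fin K → ℝ) (ε : Fin K → ℤˣ),
        (fun ξ ↦ φ ξ * signedChirpSum s 1 N ε χ ((2 : ℝ) ^ D • ξ)) =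
          signedChirpSum s (((2 : ℝ) ^ D) ^ 2) N ε a := by
  have hc : HasCompactSupport fun ξ ↦ φ ξ * χ ((2 : ℝ) ^ D • ξ) :=
    (hasCompactSupport_of_support_subset_annulus hφsupp).mul_right
  have hd : ContDiff ℝ ∞ fun ξ ↦ φ ξ * χ ((2 : ℝ) ^ D • ξ) :=
    hφ.mul ((χ.smooth ⊤).comp (contDiff_const_smul _))
  -- If |D| ≥ 2, the annulus 1/2 < |ξ| < 2 and the condition 1/2 ≤ |2^D ξ|² ≤ 2 are incompatible.
  -- For every D, dilation only multiplies the chirp frequencies by 2^{2D}.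
  refine ⟨hc.toSchwartzMap hd, fun hD ↦ ?_, fun s K N ε ↦ ?_⟩
  · ext ξ
    change φ ξ * χ ((2 : ℝ) ^ D • ξ) = 0
    by_contra hne
    obtain ⟨h1, h2⟩ := hφsupp (left_ne_zero_of_mul hne)
    obtain ⟨h3, h4⟩ := hχ _ (right_ne_zero_of_mul hne)
    have hpow : (0 : ℝ) < (2 : ℝ) ^ D := by positivity
    rw [norm_smul, Real.norm_of_nonneg hpow.le] at h3 h4
    rw [Finset.mem_Icc, not_and_or, not_le, not_le] at hD
    rcases hD with hD | hD
    · have h5 : (2 : ℝ) ^ D ≤ 2 ^ (-2 : ℤ) := zpow_le_zpow_right₀ (by norm_num) (by omega)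
      norm_num at h5
      have h6 : (2 : ℝ) ^ D * ‖ξ‖ ≤ 1 / 4 * 2 := by gcongr
      have h7 : 0 ≤ (2 : ℝ) ^ D * ‖ξ‖ := by positivity
      nlinarith
    · have h5 : (2 : ℝ) ^ (2 : ℤ) ≤ 2 ^ D := zpow_le_zpow_right₀ (by norm_num) (by omega)
      norm_num at h5
      have h6 : 4 * (1 / 2) ≤ (2 : ℝ) ^ D * ‖ξ‖ := by gcongr
      nlinarith
  · ext ξ
    rw [signedChirpSum_apply, signedChirpSum_apply]
    change _ = _ * (φ ξ * χ ((2 : ℝ) ^ D • ξ))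
    have h1 : ∀ j, chirp (1 * N j) ((2 : ℝ) ^ D • ξ) = chirp (((2 : ℝ) ^ D) ^ 2 * N j) ξ := by
      intro j
      simp only [chirp]
      rw [norm_smul, mul_pow, Real.norm_eq_abs, sq_abs]
      congr 3
      ring
    simp_rw [h1]
    ring

theorem sobolevNorm_zero (s r : ℝ) :
    sobolevNorm s r (⇑(0 : 𝓢(EuclideanSpace ℝ (Fin n), ℂ))) = 0 := by
  refine le_antisymm ((sobolevNorm_coe_le s r 0).trans ?_) zero_le
  rw [map_zero]
  have : ⇑(0 : 𝓢(EuclideanSpace ℝ (Fin n), ℂ)) = 0 := by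
    ext
    simp
  rw [this, eLpNorm_zero]

/-- On average over the signs, the Hörmander norm of a sum of `K` normalized chirps is of
size `√K`. -/
theorem exists_sum_signs_iSup_sobolevNorm_le {φ : EuclideanSpace ℝ (Fin n) → ℂ}
    (hφ : ContDiff ℝ ∞ φ) (hφsupp : Function.support φ ⊆ {ξ | 1 / 2 < ‖ξ‖ ∧ ‖ξ‖ < 2})
    {χ : 𝓢(EuclideanSpace ℝ (Fin n), ℂ)}
    (hχ : ∀ ξ, χ ξ ≠ 0 → 1 / 2 ≤ ‖ξ‖ ^ 2 ∧ ‖ξ‖ ^ 2 ≤ 2) {s r : ℝ} (hs : 0 ≤ s) (hr : 1 ≤ r)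
    {R : ℕ} (hR : r ≤ R) :
    ∃ C : ℝ≥0, ∀ (K : ℕ) (N : Fin K → ℝ), (∀ j, 1 ≤ N j) → ∃ Y : (Fin K → ℤˣ) → ℝ≥0∞,
      (∀ ε, ⨆ D : ℤ, sobolevNorm s r
        (fun ξ ↦ φ ξ * signedChirpSum s 1 N ε χ ((2 : ℝ) ^ D • ξ)) ≤ C * Y ε ^ (1 / (R : ℝ))) ∧
      ∑ ε, Y ε ≤ Fintype.card (Fin K → ℤˣ) * (C * ENNReal.ofReal (Real.sqrt K ^ R)) := by
  choose a ha0 ha using exists_mul_signedChirpSum_dilate_eq hφ hφsupp hχ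
  choose C hC using fun D : ℤ ↦ exists_sum_signs_sobolevNorm_le (n := n) hs
    (by positivity : (0 : ℝ) ≤ ((2 : ℝ) ^ D) ^ 2) hr hR (a D)
  -- With three nonzero scales, the supremum over D is controlled by sums, which are compatible with
  -- averaging over signs.
  refine ⟨∑ D ∈ Finset.Icc (-1 : ℤ) 1, C D, fun K N hN ↦ ?_⟩
  choose Y hY hYsum using fun D ↦ hC D K N hN
  refine ⟨fun ε ↦ ∑ D ∈ Finset.Icc (-1 : ℤ) 1, Y D ε, fun ε ↦ iSup_le fun D ↦ ?_, ?_⟩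
  · rw [ha]
    by_cases hD : D ∈ Finset.Icc (-1 : ℤ) 1
    · refine (hY D ε).trans ?_
      gcongr
      · exact Finset.single_le_sum (f := C) (fun _ _ ↦ zero_le) hD
      · exact Finset.single_le_sum (f := fun D ↦ Y D ε) (fun _ _ ↦ zero_le) hD
    · have : signedChirpSum s (((2 : ℝ) ^ D) ^ 2) N ε (a D) = 0 := by
        rw [ha0 D hD, signedChirpSum]
        simp
      rw [this, sobolevNorm_zero]
      exact zero_le
  · rw [Finset.sum_comm]
    refine (Finset.sum_le_sum fun D _ ↦ hYsum D).trans (le_of_eq ?_)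
    rw [← Finset.mul_sum, ← Finset.sum_mul]
    push_cast
    rfl

/-- Random sums of sufficiently separated dispersed chirps have large `L^q` norms. -/
theorem exists_card_mul_le_sum_signs_integral (hn : 1 ≤ n)
    {a : 𝓢(EuclideanSpace ℝ (Fin n), ℂ)} (ha : HasCompactSupport a) (ha0 : a ≠ 0)
    {q s : ℝ} (hq : 1 ≤ q) (hq2 : q < 2) (hs : s * q = n * (2 - q) / 2) :
    ∃ c, 0 < c ∧ ∀ K : ℕ, ∃ N : Fin K → ℝ, (∀ j, 1 ≤ N j) ∧
      Fintype.card (Fin K → ℤˣ) * (K * c) ≤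
        ∑ ε, ∫ x, ‖(𝓕⁻ (signedChirpSum s 1 N ε a)) x‖ ^ q := by
  have hq0 : 0 < q := by linarith
  obtain ⟨c, hc0, hc⟩ := exists_shell_integral_fourierInv_chirpMul_ge hn ha ha0 hq0 hq2 hs
  choose l next hl hnext hshell using hc
  -- Each shell begins where the previous one ends, and its frequency is chosen after its inner
  -- radius.
  let R : ℕ → ℝ := fun j ↦ next^[j] 0
  have hRsucc : ∀ j, R (j + 1) = next (R j) := fun j ↦ Function.iterate_succ_apply' next j 0
  have hRmono : Monotone R := monotone_nat_of_le_succ fun j ↦ by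
    rw [hRsucc]
    exact hnext _
  refine ⟨c, hc0, fun K ↦ ⟨fun j ↦ l (R j), fun j ↦ hl _, ?_⟩⟩
  set N : Fin K → ℝ := fun j ↦ l (R j) with hN
  set A : Fin K → Set (EuclideanSpace ℝ (Fin n)) := fun j ↦
    Metric.ball 0 (R (j + 1)) \ Metric.ball 0 (R j) with hA
  have hAm : ∀ j, MeasurableSet (A j) := fun j ↦ measurableSet_ball.diff measurableSet_ball
  have hAd : Pairwise (Function.onFun Disjoint A) := by
    have hlt : ∀ i j : Fin K, i < j → Disjoint (A i) (A j) := by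
      intro i j hij
      refine Set.disjoint_left.2 fun x hx hx' ↦ hx'.2 ?_
      exact Metric.ball_subset_ball (hRmono (Nat.succ_le_of_lt hij)) hx.1
    intro i j hij
    rcases lt_or_gt_of_ne hij with h | h
    · exact hlt i j h
    · exact (hlt j i h).symm
  set F : (Fin K → ℤˣ) → 𝓢(EuclideanSpace ℝ (Fin n), ℂ) := fun ε ↦
    𝓕⁻ (signedChirpSum s 1 N ε a) with hF
  have hF_apply : ∀ ε x, F ε x =
      ∑ j, ((ε j : ℤ) : ℝ) • ((N j ^ (-s) : ℝ) • (𝓕⁻ (chirpMul (N j) a)) x) := by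
    intro ε x
    simp only [hF, signedChirpSum, one_mul]
    rw [FourierTransform.fourierInv_sum, _root_.sum_apply]
    congr 1
    ext j
    rw [FourierTransform.fourierInv_smul, FourierTransform.fourierInv_smul]
    rfl
  have hFi : ∀ ε, Integrable fun x ↦ ‖F ε x‖ ^ q := fun ε ↦ (F ε).integrable_norm_rpow hq0
  have hHi : Integrable fun x ↦ ∑ ε, ‖F ε x‖ ^ q := integrable_finsetSum _ fun ε _ ↦ hFi ε
  -- On the j-th shell the sign average bounds the sum below by its j-th term alone, so the other
  -- chirps need no estimate there.
  have hpart : ∀ j, Fintype.card (Fin K → ℤˣ) * c ≤ ∫ x in A j, ∑ ε, ‖F ε x‖ ^ q := by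
    intro j
    have h1 := hshell (R j)
    rw [← hRsucc] at h1
    calc (Fintype.card (Fin K → ℤˣ) : ℝ) * c
        ≤ Fintype.card (Fin K → ℤˣ) *
          ∫ x in A j, (N j ^ (-s) * ‖(𝓕⁻ (chirpMul (N j) a)) x‖) ^ q := by gcongr
      _ = ∫ x in A j, Fintype.card (Fin K → ℤˣ) *
          (N j ^ (-s) * ‖(𝓕⁻ (chirpMul (N j) a)) x‖) ^ q := by rw [integral_const_mul]
      _ ≤ _ := by
          have hNj : 0 < N j := by linarith [hl (R j)]
          have hpt : ∀ x, Fintype.card (Fin K → ℤˣ) *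
              (N j ^ (-s) * ‖(𝓕⁻ (chirpMul (N j) a)) x‖) ^ q ≤ ∑ ε, ‖F ε x‖ ^ q := by
            intro x
            have h2 := card_mul_rpow_norm_le_sum_signs
              (fun i ↦ (N i ^ (-s) : ℝ) • (𝓕⁻ (chirpMul (N i) a)) x) j hq
            rw [norm_smul, Real.norm_of_nonneg (by positivity)] at h2
            simp_rw [hF_apply]
            exact h2
          refine integral_mono_of_nonneg (Filter.Eventually.of_forall fun x ↦ by positivity)
            hHi.integrableOn (Filter.Eventually.of_forall hpt)
  calc (Fintype.card (Fin K → ℤˣ) : ℝ) * (K * c)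
      = ∑ j : Fin K, (Fintype.card (Fin K → ℤˣ) : ℝ) * c := by
        rw [Finset.sum_const, Finset.card_univ, Fintype.card_fin, nsmul_eq_mul]
        ring
    _ ≤ ∑ j : Fin K, ∫ x in A j, ∑ ε, ‖F ε x‖ ^ q := Finset.sum_le_sum fun j _ ↦ hpart j
    _ = ∫ x in ⋃ j, A j, ∑ ε, ‖F ε x‖ ^ q :=
        (integral_iUnion_fintype hAm hAd fun j ↦ hHi.integrableOn).symm
    _ ≤ ∫ x, ∑ ε, ‖F ε x‖ ^ q :=
        setIntegral_le_integral hHi (Filter.Eventually.of_forall fun x ↦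
          Finset.sum_nonneg fun ε _ ↦ by positivity)
    _ = _ := integral_finsetSum _ fun ε _ ↦ hFi ε

/-- Boundedness of a multiplier on `L^p` transfers to the exponent `q ∈ {p, p'}`. -/
theorem eLpNorm_fourierInv_smulLeftCLM_le {M χ : 𝓢(EuclideanSpace ℝ (Fin n), ℂ)}
    (hM : ∀ ξ, M (-ξ) = M ξ) (hχ : ∀ ξ, χ (-ξ) = χ ξ) {p q : ℝ}
    (hpq : p = q ∨ p.HolderConjugate q) {B : ℝ≥0∞} (hB : B ≠ ⊤)
    (h : ∀ ψ : 𝓢(EuclideanSpace ℝ (Fin n), ℂ),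
      eLpNorm (multiplierOp M ψ) (ENNReal.ofReal p) ≤ B * eLpNorm ψ (ENNReal.ofReal p)) :
    eLpNorm (𝓕⁻ (SchwartzMap.smulLeftCLM ℂ M χ) : 𝓢(EuclideanSpace ℝ (Fin n), ℂ))
      (ENNReal.ofReal q) ≤
        B * eLpNorm (𝓕⁻ χ : 𝓢(EuclideanSpace ℝ (Fin n), ℂ)) (ENNReal.ofReal q) := by
  have hT : ∀ ψ, ⇑(SchwartzMap.fourierMultiplierCLM ℂ M ψ) = multiplierOp M ψ :=
    fourierMultiplierCLM_eq_multiplierOp M.hasTemperateGrowth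
  rcases hpq with rfl | hpq
  · have h1 := h (𝓕⁻ χ)
    rwa [← hT, SchwartzMap.fourierMultiplierCLM_apply, FourierTransform.fourier_fourierInv_eq] at h1
  · exact SchwartzMap.eLpNorm_le_of_integral_mul_eq
      (integral_fourierInv_smulLeftCLM_mul hM hχ) hpq hB fun ψ ↦ by rw [hT]; exact h ψ

/-- q is the smaller of p and p'. As |1/p - 1/2| is the same for both, s = n(1/q - 1/2). -/
theorem exists_exponent_lt_two {p s : ℝ} (hp : 1 < p) (hp2 : p ≠ 2) (hn : 1 ≤ n)
    (hps : |1 / p - 1 / 2| = s / (n : ℝ)) :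
    ∃ q, 1 < q ∧ q < 2 ∧ s * q = n * (2 - q) / 2 ∧ (p = q ∨ p.HolderConjugate q) := by
  have hn0 : (0 : ℝ) < n := by exact_mod_cast hn
  have hs : s = n * |1 / p - 1 / 2| := by
    rw [hps]
    field_simp
  have hp0 : 0 < p := by linarith
  rcases lt_or_gt_of_ne hp2 with h | h
  · refine ⟨p, hp, h, ?_, Or.inl rfl⟩
    have h1 : 1 / 2 < 1 / p := one_div_lt_one_div_of_lt hp0 h
    rw [hs, abs_of_pos (by linarith)]
    field_simp
  · have h1 : 1 / p < 1 / 2 := one_div_lt_one_div_of_lt (by norm_num) h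
    have hp1 : 0 < p - 1 := by linarith
    refine ⟨p / (p - 1), ?_, ?_, ?_, Or.inr (Real.HolderConjugate.conjExponent hp)⟩
    · rw [lt_div_iff₀ hp1]; linarith
    · rw [div_lt_iff₀ hp1]; linarith
    · rw [hs, abs_of_neg (by linarith)]
      field_simp
      ring

end Counterexample

theorem theorem1 (n : ℕ) (hn : 1 ≤ n) (p s r : ℝ) (hp : 1 < p) (hp2 : p ≠ 2) (hs : 0 < s)
    (hps : |1 / p - 1 / 2| = s / (n : ℝ)) (hr : 1 < r)
    (φ : EuclideanSpace ℝ (Fin n) → ℂ) (hφ : ContDiff ℝ ∞ φ)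
    (hφsupp : Function.support φ ⊆ {ξ | 1 / 2 < ‖ξ‖ ∧ ‖ξ‖ < 2}) :
    ¬ ∃ C : ℝ≥0, ∀ (m : EuclideanSpace ℝ (Fin n) → ℂ) (f : 𝓢(EuclideanSpace ℝ (Fin n), ℂ)),
      Measurable m → (∃ B : ℝ, ∀ ξ, ‖m ξ‖ ≤ B) →
        eLpNorm (multiplierOp m f) (ENNReal.ofReal p) ≤
          (C : ℝ≥0∞) * (⨆ D : ℤ, sobolevNorm s r (fun ξ ↦ φ ξ * m ((2 : ℝ) ^ D • ξ))) *
            eLpNorm f (ENNReal.ofReal p) := by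
  rintro ⟨C, hC⟩
  obtain ⟨q, hq1, hq2, hsq, hpq⟩ := exists_exponent_lt_two hp hp2 hn hps
  have hq0 : 0 < q := by linarith
  obtain ⟨χ, hχc, hχ0, hχe, hχs⟩ := exists_even_annulus_bump hn
  -- One factor χ is the cutoff in the multiplier, the other is the transform of the test function.
  set a : 𝓢(EuclideanSpace ℝ (Fin n), ℂ) := SchwartzMap.smulLeftCLM ℂ χ χ with ha
  have ha_apply : ∀ ξ, a ξ = χ ξ * χ ξ := fun ξ ↦
    SchwartzMap.smulLeftCLM_apply_apply χ.hasTemperateGrowth χ ξ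
  have hac : HasCompactSupport a := by
    have : ⇑a = fun ξ ↦ χ ξ * χ ξ := funext ha_apply
    rw [this]
    exact hχc.mul_left
  have ha0 : a ≠ 0 := by
    intro h
    refine hχ0 ?_
    ext ξ
    have := ha_apply ξ
    rw [h] at this
    simpa using this.symm
  -- R ≥ r serves the Sobolev bound; R ≥ 2 > q makes q/R ≤ 1 for Jensen.
  obtain ⟨R, hR⟩ := exists_nat_ge (max 2 r)
  have hR2 : (2 : ℝ) ≤ R := (le_max_left _ _).trans hR
  obtain ⟨C₁, hC₁⟩ := exists_sum_signs_iSup_sobolevNorm_le hφ hφsupp hχs hs.le hr.le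
    ((le_max_right _ _).trans hR)
  obtain ⟨c, hc0, hc⟩ := exists_card_mul_le_sum_signs_integral hn hac ha0 hq1.le hq2 hsq
  set L : ℝ≥0∞ := eLpNorm (𝓕⁻ χ : 𝓢(EuclideanSpace ℝ (Fin n), ℂ)) (ENNReal.ofReal q) with hL
  have hLtop : L ≠ ⊤ := (SchwartzMap.eLpNorm_lt_top _ _ volume).ne
  set C₂ : ℝ≥0∞ := (C * C₁ * L) ^ q * (C₁ : ℝ≥0∞) ^ (q / R) with hC₂
  have hC₂top : C₂ ≠ ⊤ := ENNReal.mul_ne_top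
    (ENNReal.rpow_ne_top_of_nonneg hq0.le
      (ENNReal.mul_ne_top (ENNReal.mul_ne_top ENNReal.coe_ne_top ENNReal.coe_ne_top) hLtop))
    (ENNReal.rpow_ne_top_of_nonneg (by positivity) ENNReal.coe_ne_top)
  -- The constants c and C₂ do not involve K or the frequencies, so K can be fixed before the
  -- frequencies are chosen.
  obtain ⟨K, hK⟩ := exists_nat_mul_gt_mul_sqrt_rpow (C := C₂.toReal) hc0 hq2
  obtain ⟨N, hN1, hN⟩ := hc K
  obtain ⟨Y, hY, hYsum⟩ := hC₁ K N hN1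
  have hYtop : ∀ ε, Y ε ≠ ⊤ := fun ε ↦ by
    refine ((Finset.single_le_sum (f := Y) (fun _ _ ↦ zero_le) (Finset.mem_univ ε)).trans
      hYsum).trans_lt ?_ |>.ne
    exact ENNReal.mul_lt_top (ENNReal.natCast_lt_top _)
      (ENNReal.mul_lt_top ENNReal.coe_lt_top ENNReal.ofReal_lt_top)
  have hbound : ∀ ε : Fin K → ℤˣ,
      ENNReal.ofReal (∫ x, ‖(𝓕⁻ (signedChirpSum s 1 N ε a)) x‖ ^ q) ≤
        (C * C₁ * L) ^ q * Y ε ^ (q / R) := by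
    intro ε
    set M := signedChirpSum s 1 N ε χ with hM
    have hMa : SchwartzMap.smulLeftCLM ℂ M χ = signedChirpSum s 1 N ε a := by
      ext ξ
      rw [SchwartzMap.smulLeftCLM_apply_apply M.hasTemperateGrowth, hM, signedChirpSum_apply,
        signedChirpSum_apply, ha_apply, smul_eq_mul, mul_assoc]
    have hMe : ∀ ξ, M (-ξ) = M ξ := by
      intro ξ
      rw [hM, signedChirpSum_apply, signedChirpSum_apply, hχe]
      simp only [chirp, norm_neg]
    have hMb : ∃ B : ℝ, ∀ ξ, ‖M ξ‖ ≤ B :=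
      ⟨_, fun ξ ↦ SchwartzMap.norm_le_seminorm ℝ M ξ⟩
    have hbdd : (C : ℝ≥0∞) * (C₁ * Y ε ^ (1 / (R : ℝ))) ≠ ⊤ :=
      ENNReal.mul_ne_top ENNReal.coe_ne_top (ENNReal.mul_ne_top ENNReal.coe_ne_top
        (ENNReal.rpow_ne_top_of_nonneg (by positivity) (hYtop ε)))
    have h1 := eLpNorm_fourierInv_smulLeftCLM_le hMe hχe hpq hbdd fun ψ ↦
      (hC M ψ M.continuous.measurable hMb).trans (by gcongr; exact hY ε)
    rw [hMa, ← hL] at h1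
    have h2 : ENNReal.ofReal (∫ x, ‖(𝓕⁻ (signedChirpSum s 1 N ε a)) x‖ ^ q) =
        (eLpNorm (𝓕⁻ (signedChirpSum s 1 N ε a) : 𝓢(EuclideanSpace ℝ (Fin n), ℂ))
          (ENNReal.ofReal q)) ^ q := by
      rw [← ENNReal.ofReal_toReal (SchwartzMap.eLpNorm_lt_top _ _ volume).ne,
        SchwartzMap.toReal_eLpNorm_eq_integral_rpow _ hq0,
        ENNReal.ofReal_rpow_of_nonneg (by positivity) hq0.le, ← Real.rpow_mul (by positivity),
        one_div_mul_cancel hq0.ne', Real.rpow_one]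
    rw [h2]
    refine (ENNReal.rpow_le_rpow h1 hq0.le).trans (le_of_eq ?_)
    have h3 : (C : ℝ≥0∞) * (C₁ * Y ε ^ (1 / (R : ℝ))) * L = (C * C₁ * L) * Y ε ^ (1 / (R : ℝ)) := by
      ring
    rw [h3, ENNReal.mul_rpow_of_nonneg _ _ hq0.le, ← ENNReal.rpow_mul]
    congr 2
    ring
  have hJ := ENNReal.sum_rpow_le_card_mul_rpow hYsum (θ := q / R) (by positivity)
    (by rw [div_le_one (by linarith)]; linarith)
  have hsqrt : (ENNReal.ofReal (Real.sqrt K ^ R)) ^ (q / R) = ENNReal.ofReal (Real.sqrt K ^ q) := by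
    rw [ENNReal.ofReal_rpow_of_nonneg (by positivity) (by positivity), ← Real.rpow_natCast,
      ← Real.rpow_mul (by positivity)]
    congr 2
    field_simp
  have hfinal : ENNReal.ofReal (Fintype.card (Fin K → ℤˣ) * (K * c)) ≤
      ENNReal.ofReal (Fintype.card (Fin K → ℤˣ) * (C₂.toReal * Real.sqrt K ^ q)) := by
    refine (ENNReal.ofReal_le_ofReal hN).trans ?_
    rw [ENNReal.ofReal_sum_of_nonneg fun ε _ ↦ by positivity]
    refine (Finset.sum_le_sum fun ε _ ↦ hbound ε).trans ?_
    rw [← Finset.mul_sum]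
    refine (mul_le_mul_right hJ _).trans (le_of_eq ?_)
    rw [ENNReal.ofReal_mul (by positivity), ENNReal.ofReal_mul ENNReal.toReal_nonneg,
      ENNReal.ofReal_toReal hC₂top, ENNReal.ofReal_natCast,
      ENNReal.mul_rpow_of_nonneg (C₁ : ℝ≥0∞) _ (by positivity), hsqrt, hC₂]
    ring
  rw [ENNReal.ofReal_le_ofReal_iff (by positivity)] at hfinal
  have hcard : (0 : ℝ) < Fintype.card (Fin K → ℤˣ) := by exact_mod_cast Fintype.card_pos
  exact absurd (le_of_mul_le_mul_left hfinal hcard) (not_le.2 hK)
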